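/- Let $(X,\theta)$ be centered jointly Gaussian with covariance matrix $\sigma_X^2\begin{pmatrix}1&\rho\\ \rho&r\end{pmatrix}$, where $\sigma_X^2>0$, $\rho\ge 0$ and $\rho^2<r$; let $\sigma_Z^2>0$, $P_T>0$ and $0<D_P\le r\sigma_X^2$. A (possibly randomized) encoder is a conditional distribution $g$ of $U$ given $(X,\theta)$ with $\mathbb E[U^2]\le P_T$; the channel output is $Y=U+Z$, where $Z\sim\mathcal N(0,\sigma_Z^2)$ is independent of $(X,\theta,U)$. A decoder is a Borel function $h$ with $\mathbb E[h(Y)^2]<\infty$, and $\hat X=h(Y)$. The decoder reacts to $g$ with a best response, i.e. a minimizer $h$ of $D_C=\mathbb E[(X-h(Y))^2]$. The encoder minimizes $D_C$, anticipating this reaction, subject to the power constraint and to the privacy constraint $$h(\theta\mid\hat X)\ \ge\ \tfrac12\log(2\pi e D_P)$$ (conditional differential entropy, in nats), or, alternatively, subject to the power constraint and to its mean squared error form $\mathbb E[(\theta-\mathbb E[\theta\mid Y])^2]\ge D_P$. A pair $(g,h)$ solving this problem is called an equilibrium. Put $$\Delta=\frac{D_P}{\sigma_X^2}\Bigl(1+\frac{\sigma_Z^2}{P_T}\Bigr)-r\,\frac{\sigma_Z^2}{P_T},\qquad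 \alpha=-\frac{\rho}{r}+\Phi,$$ $$\Phi=\min\Bigl(\sqrt{\Bigl(1-\frac{\rho^2}{r}\Bigr)\Bigl(\frac1\Delta-\frac1r\Bigr)},\ \frac{\rho}{r}\Bigr)\ \text{ if }\Delta>0,\qquad \Phi=\frac{\rho}{r}\ \text{ if }\Delta\le 0,$$ $$\beta=\sqrt{\frac{P_T}{\sigma_X^2(1+2\alpha\rho+\alpha^2r)}},\qquad \kappa=\frac1\beta\cdot\frac{P_T}{P_T+\sigma_Z^2}\cdot\frac{1+\alpha\rho}{1+\alpha^2r+2\alpha\rho}.$$ Then, for either form of the privacy constraint, $U=\beta(X+\alpha\theta)$ with $h(Y)=\kappa Y$ is an equilibrium, and it is essentially unique: for every equilibrium $(g,h)$ there is a sign $\varepsilon\in\{1,-1\}$ such that $U=\varepsilon\beta(X+\alpha\theta)$ almost surely and $h(y)=\varepsilon\kappa y$ for almost every $y$. Moreover $\alpha=0$ whenever the privacy constraint is not active, i.e. whenever some solution of the problem without the privacy constraint satisfies that constraint. -/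

import Mathlib

open MeasureTheory ProbabilityTheory
open scoped ENNReal NNReal

noncomputable section

namespace PrivateComm

/-- Conditional differential entropy `h(A | B) = -E[log p(A | B)]` in nats, where the conditional
density `p(a | b)` is the density of the law of `(A, B)` with respect to `da ⊗ P_B(db)`.
It is `-∞` if there is no conditional density, or if `log p(A | B)` is not integrable (for a
square integrable `A` the negative part of `log p(A | B)` is always integrable, so that the
expectation of `-log p(A | B)` is then really `-∞`). -/
def condDiffEntropy {Ω : Type*} [MeasurableSpace Ω] (P : Measure Ω) (A B : Ω → ℝ) : EReal :=
  open Classical in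
  if P.map (fun ω => (A ω, B ω)) ≪ (volume : Measure ℝ).prod (P.map B) ∧
      Integrable (llr (P.map (fun ω => (A ω, B ω))) ((volume : Measure ℝ).prod (P.map B)))
        (P.map (fun ω => (A ω, B ω)))
  then ((-∫ z, llr (P.map (fun ω => (A ω, B ω))) ((volume : Measure ℝ).prod (P.map B)) z
      ∂(P.map (fun ω => (A ω, B ω))) : ℝ) : EReal)
  else ⊥

/-- Outcomes `(((X, θ), U), Z)`: source, private information, channel input, channel noise. -/
abbrev Outcome : Type := ((ℝ × ℝ) × ℝ) × ℝ

/-- The source. -/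
def srcX (ω : Outcome) : ℝ := ω.1.1.1

/-- The private information. -/
def srcTheta (ω : Outcome) : ℝ := ω.1.1.2

/-- The channel input. -/
def chanIn (ω : Outcome) : ℝ := ω.1.2

/-- The channel output `Y = U + Z`. -/
def chanOut (ω : Outcome) : ℝ := ω.1.2 + ω.2

/-- The centered bivariate Gaussian law of `(X, θ)` with covariance matrix
`σ_X² [[1, ρ], [ρ, r]]`; here `vX = σ_X²`. -/
structure IsSourceLaw (src : Measure (ℝ × ℝ)) (vX ρ r : ℝ) : Prop where
  gaussian : IsGaussian src
  mean_fst : ∫ p, p.1 ∂src = 0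
  mean_snd : ∫ p, p.2 ∂src = 0
  var_fst : ∫ p, p.1 ^ 2 ∂src = vX
  cov : ∫ p, p.1 * p.2 ∂src = vX * ρ
  var_snd : ∫ p, p.2 ^ 2 ∂src = vX * r

/-- The law of `(((X, θ), U), Z)`, when the (possibly randomized) encoder draws `U` from the
conditional distribution `g (X, θ)`, and `Z ∼ N(0, vZ)` is independent of `(X, θ, U)`. -/
def systemLaw (src : Measure (ℝ × ℝ)) (vZ : ℝ) (g : Kernel (ℝ × ℝ) ℝ) : Measure Outcome :=
  (src.compProd g).prod (gaussianReal 0 vZ.toNNReal)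

/-- Mean squared error of the decoder `h`: `E (X - h(Y))²`. -/
def distortion (P : Measure Outcome) (h : ℝ → ℝ) : ℝ :=
  ∫ ω, (srcX ω - h (chanOut ω)) ^ 2 ∂P

/-- Admissible decoders: Borel measurable functions with `E h(Y)² < ∞`. -/
def IsDecoder (P : Measure Outcome) (h : ℝ → ℝ) : Prop :=
  Measurable h ∧ MemLp (fun ω => h (chanOut ω)) 2 P

/-- `h` minimizes the mean squared error over all admissible decoders: the reaction of the
follower, who does not care about privacy. -/
def IsBestResponse (P : Measure Outcome) (h : ℝ → ℝ) : Prop :=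
  IsDecoder P h ∧ ∀ h' : ℝ → ℝ, IsDecoder P h' → distortion P h ≤ distortion P h'

/-- A privacy constraint, imposed on the law of the system and the decoder. -/
abbrev PrivacyConstraint : Type := Measure Outcome → (ℝ → ℝ) → Prop

/-- Entropy based privacy against an inspector who sees `X̂ = h(Y)`:
`h(θ | X̂) ≥ (1/2) log (2 π e D_P)`. -/
def entropyPrivacy (DP : ℝ) : PrivacyConstraint := fun P h =>
  (((1 / 2) * Real.log (2 * Real.pi * Real.exp 1 * DP) : ℝ) : EReal) ≤
    condDiffEntropy P srcTheta (fun ω => h (chanOut ω))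

/-- The mean squared error form of the constraint: `E (θ - E[θ | Y])² ≥ D_P`. -/
def mmsePrivacy (DP : ℝ) : PrivacyConstraint := fun P _ =>
  DP ≤ ∫ ω, (srcTheta ω - (P[srcTheta | MeasurableSpace.comap chanOut inferInstance]) ω) ^ 2 ∂P

/-- No privacy constraint. -/
def noPrivacy : PrivacyConstraint := fun _ _ => True

/-- What the leader may play: an encoder `g` with average power at most `PT`, such that the
privacy constraint holds for the decoder `h` with which the follower reacts to `g`. -/
structure IsFeasible (src : Measure (ℝ × ℝ)) (vZ PT : ℝ) (priv : PrivacyConstraint)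
    (g : Kernel (ℝ × ℝ) ℝ) (h : ℝ → ℝ) : Prop where
  markov : IsMarkovKernel g
  sq_integrable : MemLp chanIn 2 (systemLaw src vZ g)
  power : ∫ ω, chanIn ω ^ 2 ∂(systemLaw src vZ g) ≤ PT
  response : IsBestResponse (systemLaw src vZ g) h
  privacy : priv (systemLaw src vZ g) h

/-- Constrained Stackelberg equilibrium: the encoder minimizes the distortion among all feasible
encoders, knowing that the decoder reacts with a best response. -/
def IsEquilibrium (src : Measure (ℝ × ℝ)) (vZ PT : ℝ) (priv : PrivacyConstraint)
    (g : Kernel (ℝ × ℝ) ℝ) (h : ℝ → ℝ) : Prop :=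
  IsFeasible src vZ PT priv g h ∧
    ∀ (g' : Kernel (ℝ × ℝ) ℝ) (h' : ℝ → ℝ), IsFeasible src vZ PT priv g' h' →
      distortion (systemLaw src vZ g) h ≤ distortion (systemLaw src vZ g') h'

/-- The deterministic encoder `U = β (X + α θ)`. -/
def linearEncoder (β α : ℝ) : Kernel (ℝ × ℝ) ℝ :=
  Kernel.deterministic (fun p : ℝ × ℝ => β * (p.1 + α * p.2)) (by fun_prop)

/-- The normalized privacy level `(D_P / σ_X²) (1 + σ_Z² / P_T) - r σ_Z² / P_T`. -/
def privLevel (vX r vZ PT DP : ℝ) : ℝ := DP / vX * (1 + vZ / PT) - r * (vZ / PT)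

/-- `Φ = min (√((1 - ρ²/r) (1/Δ - 1/r)), ρ/r)` with `Δ` the normalized privacy level; for
`Δ ≤ 0`, where the channel noise alone provides the privacy, `Φ = ρ/r`. -/
def Phi (vX ρ r vZ PT DP : ℝ) : ℝ :=
  if 0 < privLevel vX r vZ PT DP then
    min (Real.sqrt ((1 - ρ ^ 2 / r) * (1 / privLevel vX r vZ PT DP - 1 / r))) (ρ / r)
  else ρ / r

/-- `α = -ρ/r + Φ`. -/
def alpha (vX ρ r vZ PT DP : ℝ) : ℝ := -(ρ / r) + Phi vX ρ r vZ PT DP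

/-- The gain `√(P_T / (σ_X² (1 + 2 α ρ + α² r)))` that scales `X + α θ` to power `P_T`. -/
def gain (vX ρ r PT α : ℝ) : ℝ := Real.sqrt (PT / (vX * (1 + 2 * α * ρ + α ^ 2 * r)))

/-- The slope `κ = (1/β) (P_T / (P_T + σ_Z²)) (1 + αρ) / (1 + α² r + 2αρ)` of the linear
decoder, `β` being the gain. -/
def slope (vX ρ r vZ PT α : ℝ) : ℝ :=
  1 / gain vX ρ r PT α * (PT / (PT + vZ)) * ((1 + α * ρ) / (1 + α ^ 2 * r + 2 * α * ρ))

end PrivateComm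

end

/-!
The proof reduces everything to two moments of the estimate `X̂ = h(Y)`: `m = E X̂²` and
`n = E θ X̂`. Since `h` is a best response, `E X X̂ = m` (only rescalings of `h` are needed for
this), so the distortion is `σ_X² - m` and the encoder wants `m` as large as possible.

*Converse.* Let `S` be centered Gaussian with variance `v`, `Y = U + Z` with `E U² ≤ p`, and let
`f` be any decoder. The joint "density" of `(S, U, Y)` is compared with the one in which `S` given
`Y` is `N(f(Y), d)` and `Y` is `N(0, p + N)`, where `d = v N / (p + N)`. The logarithm of the ratio
is the explicit quadratic expression `logRatio`; the exponential of it has expectation one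
(`lintegral_exp_logRatio`), so by Jensen the quadratic expression has nonpositive expectation,
which is exactly `d ≤ E (S - f(Y))²` (`le_integral_sq_sub`). This is the rate-distortion bound
for a Gaussian source over a Gaussian channel, without any mutual information. In case of equality
the quadratic expression vanishes almost surely, and comparing coefficients of `y` forces `f` and
`U` to be linear with determined slopes, up to a common sign (`eq_linear_of_logRatio_eq_zero`).

With `S = X + α θ` and `f` a multiple of `h` one gets
`(m + α n)² ≤ P_T / (P_T + σ_Z²) · Var(X + α θ) · m` (`IsFeasible.sq_le`). Either privacy constraint
gives `D_P ≤ E (θ - c X̂)²` for every `c`, i.e. `n² ≤ (r σ_X² - D_P) m`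
(`sq_integral_mul_le_of_privacy`); for the entropy, this is Gibbs' inequality against the
conditional density `N(c X̂, D_P)`. As `α ≤ 0`, the two inequalities together bound `m`
(`second_moment_le`), and the value of `α` is such that the linear scheme attains the bound
(`alpha_spec`).

*Achievability.* Under the linear encoder everything is jointly Gaussian, so the residual of a
linear regression on `Y` is independent of `Y` (`linearEncoder_residual`); this yields the best
response and both forms of privacy.

*Inactive constraint.* An optimum of the unconstrained problem has `m = P_T / (P_T + σ_Z²) · σ_X²`,
and the bound for `S = X + a θ`, tight at `a = 0`, is stationary there, so `n = ρ m`
(`cross_moment_of_optimal`). If such an optimum is private, the defining equation of a nonzero `α`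
cannot hold.
-/

noncomputable section

namespace PrivateComm

/-! ### Gaussian integrals and the density ratio -/

lemma lintegral_gaussianReal_eq (m : ℝ) {v : ℝ} (hv : 0 < v) {f : ℝ → ℝ≥0∞} :
    ∫⁻ x, f x ∂(gaussianReal m v.toNNReal) =
      ENNReal.ofReal (√(2 * Real.pi * v))⁻¹ *
        ∫⁻ x, ENNReal.ofReal (Real.exp (-(x - m) ^ 2 / (2 * v))) * f x := by
  have hv' : v.toNNReal ≠ 0 := by simpa using hv
  rw [gaussianReal_of_var_ne_zero _ hv', lintegral_withDensity_eq_lintegral_mul_non_measurable _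
    (measurable_gaussianPDF _ _) (by simp [gaussianPDF_lt_top]), ← lintegral_const_mul' _ _ (by simp)]
  refine lintegral_congr fun x => ?_
  simp only [Pi.mul_apply, gaussianPDF, gaussianPDFReal, Real.coe_toNNReal _ hv.le]
  rw [ENNReal.ofReal_mul (by positivity), mul_assoc]

lemma lintegral_exp_neg_sq (m : ℝ) {v : ℝ} (hv : 0 < v) :
    ∫⁻ x, ENNReal.ofReal (Real.exp (-(x - m) ^ 2 / (2 * v))) =
      ENNReal.ofReal √(2 * Real.pi * v) := by
  have h := lintegral_gaussianReal_eq m hv (f := fun _ => 1)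
  have hs : 0 < √(2 * Real.pi * v) := by positivity
  simp only [lintegral_const, measure_univ, mul_one] at h
  have h2 := congrArg (fun t => ENNReal.ofReal √(2 * Real.pi * v) * t) h
  simp only [mul_one, ← mul_assoc] at h2
  rw [← ENNReal.ofReal_mul hs.le, mul_inv_cancel₀ hs.ne', ENNReal.ofReal_one, one_mul] at h2
  exact h2.symm

lemma lintegral_exp_mul_gaussianReal {v : ℝ} (hv : 0 < v) (f : ℝ → ℝ) :
    ∫⁻ x, ENNReal.ofReal (Real.exp (x ^ 2 / (2 * v) + f x)) ∂(gaussianReal 0 v.toNNReal) =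
      ENNReal.ofReal (√(2 * Real.pi * v))⁻¹ * ∫⁻ x, ENNReal.ofReal (Real.exp (f x)) := by
  rw [lintegral_gaussianReal_eq 0 hv]
  congr 1
  refine lintegral_congr fun x => ?_
  rw [← ENNReal.ofReal_mul (by positivity), ← Real.exp_add]
  congr 2
  ring

/-- Logarithm of `q(y) r(s | y) / (φ(s) p(y | u))` at `(s, u, y)`, where `φ`, `p(· | u)`, `q` and
`r(· | y)` are the densities of `N(0, v)`, `N(u, N)`, `N(0, p + N)` and `N(f y, d)`. The normalizing
constants are left out: they cancel for `d = v N / (p + N)`. The shape `(y - 0) ^ 2` and the order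
of the summands match the Gaussian integrals in which they are absorbed one after the other. -/
def logRatio (v N p d : ℝ) (f : ℝ → ℝ) (s u y : ℝ) : ℝ :=
  (y - u) ^ 2 / (2 * N) + (s ^ 2 / (2 * v) + (-(y - 0) ^ 2 / (2 * (p + N))
    + -(s - f y) ^ 2 / (2 * d)))

section
variable {α : Type*} [MeasurableSpace α] {μ : Measure α} {s u : α → ℝ} {f : ℝ → ℝ} {v N p d : ℝ}

lemma measurable_logRatio (hs : Measurable s) (hu : Measurable u) (hf : Measurable f) :
    Measurable (fun ω : α × ℝ => logRatio v N p d f (s ω.1) (u ω.1) (u ω.1 + ω.2)) := by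
  unfold logRatio
  fun_prop

/-- The density ratio integrates to one: under the law of `(S, U, Y)` the integrand becomes
`q(y) r(s | y) ds dy`, whatever `U` is. -/
lemma lintegral_exp_logRatio [IsProbabilityMeasure μ] (hs : Measurable s) (hu : Measurable u) (hf : Measurable f)
    (hv : 0 < v) (hN : 0 < N) (hp : 0 < p) (hd : d = v * N / (p + N))
    (hlaw : μ.map s = gaussianReal 0 v.toNNReal) :
    ∫⁻ ω, ENNReal.ofReal (Real.exp (logRatio v N p d f (s ω.1) (u ω.1) (u ω.1 + ω.2)))
      ∂(μ.prod (gaussianReal 0 N.toNNReal)) = 1 := by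
  have hd0 : 0 < d := by rw [hd]; positivity
  let G : ℝ → ℝ → ℝ := fun a y => -(y - 0) ^ 2 / (2 * (p + N)) + -(a - f y) ^ 2 / (2 * d)
  have hG : Measurable (fun q : ℝ × ℝ => ENNReal.ofReal (Real.exp (G q.1 q.2))) := by
    simp only [G]; fun_prop
  rw [lintegral_prod _
    (measurable_logRatio hs hu hf).exp.ennreal_ofReal.aemeasurable]
  have h1 : ∀ a, ∫⁻ z, ENNReal.ofReal (Real.exp (logRatio v N p d f (s a) (u a) (u a + z)))
      ∂(gaussianReal 0 N.toNNReal) = ENNReal.ofReal (√(2 * Real.pi * N))⁻¹ *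
        (ENNReal.ofReal (Real.exp ((s a) ^ 2 / (2 * v))) *
          ∫⁻ y, ENNReal.ofReal (Real.exp (G (s a) y))) := by
    intro a
    have := lintegral_exp_mul_gaussianReal hN (fun z => (s a) ^ 2 / (2 * v) + G (s a) (u a + z))
    simp only [logRatio, add_sub_cancel_left]
    rw [this, lintegral_add_left_eq_self
      (fun y => ENNReal.ofReal (Real.exp ((s a) ^ 2 / (2 * v) + G (s a) y))),
      ← lintegral_const_mul' _ _ (by simp)]
    simp_rw [Real.exp_add, ENNReal.ofReal_mul (Real.exp_nonneg _)]
    rw [lintegral_const_mul' _ _ (by simp), lintegral_const_mul' _ _ (by simp)]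
  simp_rw [h1]
  have hH : Measurable (fun b => ∫⁻ y, ENNReal.ofReal (Real.exp (G b y))) :=
    hG.lintegral_prod_right'
  rw [lintegral_const_mul' _ _ (by simp), ← lintegral_map
    (f := fun b => ENNReal.ofReal (Real.exp (b ^ 2 / (2 * v))) *
          ∫⁻ y, ENNReal.ofReal (Real.exp (G b y))) (by fun_prop) hs, hlaw]
  have h2 : ∫⁻ b, ENNReal.ofReal (Real.exp (b ^ 2 / (2 * v))) *
          (∫⁻ y, ENNReal.ofReal (Real.exp (G b y))) ∂(gaussianReal 0 v.toNNReal) = 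
      ENNReal.ofReal (√(2 * Real.pi * v))⁻¹ * ∫⁻ b, ∫⁻ y, ENNReal.ofReal (Real.exp (G b y)) := by
    rw [lintegral_gaussianReal_eq 0 hv]
    congr 1
    refine lintegral_congr fun x => ?_
    rw [← mul_assoc, ← ENNReal.ofReal_mul (by positivity), ← Real.exp_add]
    have : -(x - 0) ^ 2 / (2 * v) + x ^ 2 / (2 * v) = 0 := by ring
    rw [this]; simp
  rw [h2, lintegral_lintegral_swap hG.aemeasurable]
  have h3 : ∀ y, ∫⁻ b, ENNReal.ofReal (Real.exp (G b y)) =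
      ENNReal.ofReal (Real.exp (-(y - 0) ^ 2 / (2 * (p + N)))) *
        ENNReal.ofReal √(2 * Real.pi * d) := by
    intro y
    rw [← lintegral_exp_neg_sq (f y) hd0, ← lintegral_const_mul' _ _ (by simp)]
    simp only [G, Real.exp_add, ENNReal.ofReal_mul (Real.exp_nonneg _)]
  simp_rw [h3]
  rw [lintegral_mul_const' _ _ (by simp), lintegral_exp_neg_sq 0 (by positivity : 0 < p + N),
    ← ENNReal.ofReal_mul (by positivity), ← ENNReal.ofReal_mul (by positivity),
    ← ENNReal.ofReal_mul (by positivity), ← ENNReal.ofReal_one]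
  congr 1
  rw [← Real.sqrt_mul (by positivity), ← mul_assoc, ← mul_inv, ← Real.sqrt_mul (by positivity)]
  have : 2 * Real.pi * (p + N) * (2 * Real.pi * d) = 2 * Real.pi * N * (2 * Real.pi * v) := by
    rw [hd]; field_simp
  rw [this, inv_mul_cancel₀ (by positivity)]


lemma integral_sq_gaussianReal {v : ℝ} (hv : 0 ≤ v) :
    ∫ x, x ^ 2 ∂(gaussianReal 0 v.toNNReal) = v := by
  rw [← variance_of_integral_eq_zero (X := fun x : ℝ => x) aemeasurable_id' integral_id_gaussianReal,
    variance_fun_id_gaussianReal, Real.coe_toNNReal _ hv]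

lemma memLp_two_gaussianReal (m : ℝ) (v : ℝ≥0) : MemLp (fun x : ℝ => x) 2 (gaussianReal m v) :=
  memLp_id_gaussianReal' 2 (by simp)

lemma memLp_two_of_map_eq (hs : Measurable s) (hlaw : μ.map s = gaussianReal 0 v.toNNReal) :
    MemLp s 2 μ := by
  have h := memLp_two_gaussianReal 0 v.toNNReal
  rw [← hlaw] at h
  exact (memLp_map_measure_iff (by fun_prop) hs.aemeasurable).1 h

lemma integral_sq_of_map_eq (hv : 0 ≤ v) (hs : Measurable s)
    (hlaw : μ.map s = gaussianReal 0 v.toNNReal) : ∫ a, s a ^ 2 ∂μ = v := by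
  rw [← integral_sq_gaussianReal hv, ← hlaw, integral_map hs.aemeasurable (by fun_prop)]

lemma integral_sq_add_noise [IsProbabilityMeasure μ] (hN : 0 ≤ N) (hu2 : MemLp u 2 μ) :
    ∫ ω, (u ω.1 + ω.2) ^ 2 ∂(μ.prod (gaussianReal 0 N.toNNReal)) = ∫ a, u a ^ 2 ∂μ + N := by
  set γ := gaussianReal 0 N.toNNReal
  have hz : MemLp (fun x : ℝ => x) 2 γ := memLp_two_gaussianReal 0 _
  have hU := hu2.comp_fst (ν := γ)
  have hZ := hz.comp_snd (μ := μ)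
  have e : ∀ ω : α × ℝ, (u ω.1 + ω.2) ^ 2 = u ω.1 ^ 2 + 2 * (u ω.1 * ω.2) + ω.2 ^ 2 := by
    intro ω; ring
  simp_rw [e]
  have i1 : Integrable (fun ω : α × ℝ => u ω.1 ^ 2) (μ.prod γ) := hU.integrable_sq
  have i2 : Integrable (fun ω : α × ℝ => 2 * (u ω.1 * ω.2)) (μ.prod γ) :=
    (hU.integrable_mul hZ).const_mul 2
  have i3 : Integrable (fun ω : α × ℝ => ω.2 ^ 2) (μ.prod γ) := hZ.integrable_sq
  have i12 : Integrable (fun ω : α × ℝ => u ω.1 ^ 2 + 2 * (u ω.1 * ω.2)) (μ.prod γ) := i1.add i2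
  rw [integral_add i12 i3, integral_add i1 i2, integral_const_mul,
    integral_prod_mul u (fun x : ℝ => x), integral_id_gaussianReal,
    integral_fun_fst (fun a => u a ^ 2), integral_fun_snd (fun x : ℝ => x ^ 2), integral_sq_gaussianReal hN]
  simp

lemma integral_logRatio [IsProbabilityMeasure μ] (hs : Measurable s)
    (hv : 0 < v) (hN : 0 < N)
    (hlaw : μ.map s = gaussianReal 0 v.toNNReal) (hu2 : MemLp u 2 μ)
    (hf2 : MemLp (fun ω : α × ℝ => f (u ω.1 + ω.2)) 2 (μ.prod (gaussianReal 0 N.toNNReal))) :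
    Integrable (fun ω : α × ℝ => logRatio v N p d f (s ω.1) (u ω.1) (u ω.1 + ω.2))
      (μ.prod (gaussianReal 0 N.toNNReal)) ∧
    ∫ ω, logRatio v N p d f (s ω.1) (u ω.1) (u ω.1 + ω.2) ∂(μ.prod (gaussianReal 0 N.toNNReal)) =
      1 - (∫ a, u a ^ 2 ∂μ + N) / (2 * (p + N)) -
        (∫ ω, (s ω.1 - f (u ω.1 + ω.2)) ^ 2 ∂(μ.prod (gaussianReal 0 N.toNNReal))) / (2 * d) := by
  rw [← integral_sq_add_noise hN.le hu2]
  set γ := gaussianReal 0 N.toNNReal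
  have hz : MemLp (fun x : ℝ => x) 2 γ := memLp_two_gaussianReal 0 _
  have hU := hu2.comp_fst (ν := γ)
  have hZ := hz.comp_snd (μ := μ)
  have hS := (memLp_two_of_map_eq hs hlaw).comp_fst (ν := γ)
  have e : ∀ ω : α × ℝ, logRatio v N p d f (s ω.1) (u ω.1) (u ω.1 + ω.2) =
      ω.2 ^ 2 / (2 * N) + s ω.1 ^ 2 / (2 * v) - (u ω.1 + ω.2) ^ 2 / (2 * (p + N))
        - (s ω.1 - f (u ω.1 + ω.2)) ^ 2 / (2 * d) := by
    intro ω; simp only [logRatio, add_sub_cancel_left]; ring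
  have i1 : Integrable (fun ω : α × ℝ => ω.2 ^ 2 / (2 * N)) (μ.prod γ) :=
    hZ.integrable_sq.div_const _
  have i2 : Integrable (fun ω : α × ℝ => s ω.1 ^ 2 / (2 * v)) (μ.prod γ) :=
    hS.integrable_sq.div_const _
  have i3 : Integrable (fun ω : α × ℝ => (u ω.1 + ω.2) ^ 2 / (2 * (p + N))) (μ.prod γ) :=
    (hU.add hZ).integrable_sq.div_const _
  have i4 : Integrable (fun ω : α × ℝ => (s ω.1 - f (u ω.1 + ω.2)) ^ 2 / (2 * d)) (μ.prod γ) :=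
    (hS.sub hf2).integrable_sq.div_const _
  simp_rw [e]
  refine ⟨((i1.add i2).sub i3).sub i4, ?_⟩
  have i12 : Integrable (fun ω : α × ℝ => ω.2 ^ 2 / (2 * N) + s ω.1 ^ 2 / (2 * v)) (μ.prod γ) :=
    i1.add i2
  have i123 : Integrable (fun ω : α × ℝ => ω.2 ^ 2 / (2 * N) + s ω.1 ^ 2 / (2 * v)
      - (u ω.1 + ω.2) ^ 2 / (2 * (p + N))) (μ.prod γ) := i12.sub i3
  rw [integral_sub i123 i4, integral_sub i12 i3, integral_add i1 i2,
    integral_div, integral_div, integral_div, integral_div,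
    integral_fun_fst (fun a => s a ^ 2), integral_fun_snd (fun x : ℝ => x ^ 2),
    integral_sq_gaussianReal hN.le, integral_sq_of_map_eq hv.le hs hlaw]
  simp only [probReal_univ, one_smul]
  field_simp
  ring

/-- Jensen's inequality for the exponential, with its equality case. -/
lemma integral_nonpos_of_lintegral_exp_le_one {Ω : Type*} [MeasurableSpace Ω] {P : Measure Ω}
    [IsProbabilityMeasure P] {L : Ω → ℝ} (hL : Integrable L P)
    (h : ∫⁻ ω, ENNReal.ofReal (Real.exp (L ω)) ∂P ≤ 1) :
    ∫ ω, L ω ∂P ≤ 0 ∧ (0 ≤ ∫ ω, L ω ∂P → ∀ᵐ ω ∂P, L ω = 0) := by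
  have hm : AEStronglyMeasurable (fun ω => Real.exp (L ω)) P :=
    Real.continuous_exp.comp_aestronglyMeasurable hL.1
  have hE : Integrable (fun ω => Real.exp (L ω)) P := by
    refine ⟨hm, ?_⟩
    rw [hasFiniteIntegral_iff_ofReal (.of_forall fun _ => Real.exp_nonneg _)]
    exact h.trans_lt ENNReal.one_lt_top
  have hE1 : ∫ ω, Real.exp (L ω) ∂P ≤ 1 := by
    rw [integral_eq_lintegral_of_nonneg_ae (.of_forall fun _ => Real.exp_nonneg _) hm]
    exact ENNReal.toReal_le_of_le_ofReal zero_le_one (by simpa using h)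
  have h0 : ∀ ω, 0 ≤ Real.exp (L ω) - 1 - L ω := fun ω => by
    linarith [Real.add_one_le_exp (L ω)]
  have hi : ∫ ω, (Real.exp (L ω) - 1 - L ω) ∂P ≤ -∫ ω, L ω ∂P := by
    have hE' : Integrable (fun ω => Real.exp (L ω) - 1) P := hE.sub (integrable_const _)
    rw [integral_sub hE' hL, integral_sub hE (integrable_const _)]
    simp only [integral_const, probReal_univ, one_smul]
    linarith
  have hnn := integral_nonneg (μ := P) (f := fun ω => Real.exp (L ω) - 1 - L ω) h0
  refine ⟨by linarith, fun h1 => ?_⟩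
  have hz := (integral_eq_zero_iff_of_nonneg h0 ((hE.sub (integrable_const _)).sub hL)).1
    (le_antisymm (hi.trans (by linarith)) hnn)
  filter_upwards [hz] with ω hω
  by_contra hne
  have := Real.add_one_lt_exp hne
  simp only [Pi.zero_apply] at hω
  linarith

/-- A Gaussian source of variance `v`, sent with power `p` over a channel with Gaussian noise of
variance `N`, cannot be reconstructed with a mean squared error below `v N / (p + N)`. In case of
equality the density ratio is trivial. -/
theorem le_integral_sq_sub [IsProbabilityMeasure μ] (hs : Measurable s) (hu : Measurable u)
    (hf : Measurable f) (hv : 0 < v) (hN : 0 < N) (hp : 0 < p) (hd : d = v * N / (p + N))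
    (hlaw : μ.map s = gaussianReal 0 v.toNNReal) (hu2 : MemLp u 2 μ) (hup : ∫ a, u a ^ 2 ∂μ ≤ p)
    (hf2 : MemLp (fun ω : α × ℝ => f (u ω.1 + ω.2)) 2 (μ.prod (gaussianReal 0 N.toNNReal))) :
    d ≤ ∫ ω, (s ω.1 - f (u ω.1 + ω.2)) ^ 2 ∂(μ.prod (gaussianReal 0 N.toNNReal)) ∧
    (∫ ω, (s ω.1 - f (u ω.1 + ω.2)) ^ 2 ∂(μ.prod (gaussianReal 0 N.toNNReal)) ≤ d →
      ∀ᵐ ω ∂(μ.prod (gaussianReal 0 N.toNNReal)),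
        logRatio v N p d f (s ω.1) (u ω.1) (u ω.1 + ω.2) = 0) := by
  have hd0 : 0 < d := by rw [hd]; positivity
  obtain ⟨hi, he⟩ := integral_logRatio (p := p) (d := d) hs hv hN hlaw hu2 hf2
  obtain ⟨h1, h2⟩ := integral_nonpos_of_lintegral_exp_le_one hi
    (lintegral_exp_logRatio hs hu hf hv hN hp hd hlaw).le
  rw [he] at h1 h2
  set D := ∫ ω, (s ω.1 - f (u ω.1 + ω.2)) ^ 2 ∂(μ.prod (gaussianReal 0 N.toNNReal))
  have hA : (∫ a, u a ^ 2 ∂μ + N) / (2 * (p + N)) ≤ 1 / 2 := by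
    rw [div_le_div_iff₀ (by positivity) (by positivity)]; linarith
  constructor
  · have : 1 / 2 ≤ D / (2 * d) := by linarith
    rw [div_le_div_iff₀ (by positivity) (by positivity)] at this
    linarith
  · intro hD
    refine h2 ?_
    have : D / (2 * d) ≤ 1 / 2 := by
      rw [div_le_div_iff₀ (by positivity) (by positivity)]; linarith
    linarith

end

/-! ### The equality case -/

lemma ae_quadratic_eq_zero {a b c : ℝ} (h : ∀ᵐ y : ℝ, a * y ^ 2 + b * y + c = 0) :
    a = 0 ∧ b = 0 ∧ c = 0 := by
  have hc : (fun y : ℝ => a * y ^ 2 + b * y + c) = fun _ => 0 :=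
    Continuous.ae_eq_iff_eq volume (by fun_prop) (by fun_prop) |>.1 h
  have h0 := congrFun hc 0
  have h1 := congrFun hc 1
  have h2 := congrFun hc (-1)
  norm_num at h0 h1 h2
  refine ⟨by linarith, by linarith, by linarith⟩

section
variable {α : Type*} [MeasurableSpace α] {μ : Measure α} {s u : α → ℝ} {f : ℝ → ℝ} {v N p d : ℝ}

/-- Given the input, the output of the channel has a law equivalent to Lebesgue measure. -/
lemma ae_ae_of_ae_prod_gaussianReal (hN : 0 < N) {Q : α → ℝ → Prop}
    (h : ∀ᵐ ω ∂(μ.prod (gaussianReal 0 N.toNNReal)), Q ω.1 (u ω.1 + ω.2)) :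
    ∀ᵐ a ∂μ, ∀ᵐ y : ℝ, Q a y := by
  filter_upwards [Measure.ae_ae_of_ae_prod h] with a ha
  have h1 : ∀ᵐ z : ℝ, Q a (u a + z) :=
    (gaussianReal_absolutelyContinuous' 0 (by simpa using hN)).ae_le ha
  have h2 := (measurePreserving_add_left (volume : Measure ℝ) (-u a)).quasiMeasurePreserving.ae h1
  simpa using h2

/-- A Gaussian variable has no atoms, so it takes two different values on any almost sure event. -/
lemma exists_ne_of_map_eq_gaussianReal [IsProbabilityMeasure μ] (hs : Measurable s) (hv : 0 < v)
    (hlaw : μ.map s = gaussianReal 0 v.toNNReal) {Q : α → Prop} (hQ : ∀ᵐ a ∂μ, Q a) :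
    ∃ a b, Q a ∧ Q b ∧ s a ≠ s b := by
  obtain ⟨a, ha⟩ := hQ.exists
  have : ∀ᵐ b ∂μ, s b ≠ s a := by
    refine ae_of_ae_map hs.aemeasurable (p := fun x => x ≠ s a) ?_
    rw [hlaw]
    have := nullSingletonClass_gaussianReal (μ := 0) (v := v.toNNReal) (by simpa using hv)
    exact Measure.ae_ne _ _
  obtain ⟨b, hb, hb'⟩ := (hQ.and this).exists
  exact ⟨a, b, ha, hb, hb'.symm⟩

/-- If the density ratio is trivial, then for almost every `(s, u)` the expression `logRatio`
vanishes for almost every `y`. Two values of `s` show that `f` is affine, and comparing coefficients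
of `y` then determines `u` and `f`. -/
theorem eq_linear_of_logRatio_eq_zero [IsProbabilityMeasure μ] (hs : Measurable s)
    (hv : 0 < v) (hN : 0 < N) (hp : 0 < p) (hd : d = v * N / (p + N))
    (hlaw : μ.map s = gaussianReal 0 v.toNNReal)
    (h : ∀ᵐ ω ∂(μ.prod (gaussianReal 0 N.toNNReal)),
        logRatio v N p d f (s ω.1) (u ω.1) (u ω.1 + ω.2) = 0) :
    ∃ ε : ℝ, (ε = 1 ∨ ε = -1) ∧ (∀ᵐ a ∂μ, u a = ε * (√(p / v) * s a)) ∧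
      ∀ᵐ y : ℝ, f y = ε * (√(v * p) / (p + N) * y) := by
  have hd0 : 0 < d := by rw [hd]; positivity
  have hpN : 0 < p + N := by positivity
  have h1 := ae_ae_of_ae_prod_gaussianReal hN (Q := fun a y => logRatio v N p d f (s a) (u a) y = 0) h
  obtain ⟨a, b, ha, hb, hab⟩ := exists_ne_of_map_eq_gaussianReal hs hv hlaw h1
  have hab' : s a - s b ≠ 0 := sub_ne_zero.2 hab
  obtain ⟨κ, c, hf⟩ : ∃ κ c : ℝ, ∀ᵐ y : ℝ, f y = κ * y + c := by
    refine ⟨d * (u a - u b) / (N * (s a - s b)), (s a + s b) / 2 -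
      d / (2 * (s a - s b)) * ((s a ^ 2 - s b ^ 2) / v + (u a ^ 2 - u b ^ 2) / N), ?_⟩
    filter_upwards [ha, hb] with y hya hyb
    have e : logRatio v N p d f (s a) (u a) y - logRatio v N p d f (s b) (u b) y = 0 := by
      rw [hya, hyb, sub_zero]
    have e2 : (y - u a) ^ 2 / N + s a ^ 2 / v - (s a - f y) ^ 2 / d -
        ((y - u b) ^ 2 / N + s b ^ 2 / v - (s b - f y) ^ 2 / d) = 0 := by
      simp only [logRatio] at e
      generalize p + N = q at e
      linear_combination 2 * e
    field_simp at e2 ⊢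
    linear_combination e2
  have h2 : ∀ᵐ x ∂μ, 1 / N - 1 / (p + N) - κ ^ 2 / d = 0 ∧
      (u x / N = κ * (s x - c) / d) ∧ (u x ^ 2 / N + s x ^ 2 / v - (s x - c) ^ 2 / d = 0) := by
    filter_upwards [h1] with x hx
    have h3 : ∀ᵐ y : ℝ, (1 / N - 1 / (p + N) - κ ^ 2 / d) * y ^ 2 +
        (-2 * (u x / N - κ * (s x - c) / d)) * y +
          (u x ^ 2 / N + s x ^ 2 / v - (s x - c) ^ 2 / d) = 0 := by
      filter_upwards [hx, hf] with y hy hfy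
      simp only [logRatio, hfy] at hy
      generalize p + N = q at hy ⊢
      linear_combination 2 * hy
    obtain ⟨h4, h5, h6⟩ := ae_quadratic_eq_zero h3
    exact ⟨h4, by linarith, h6⟩
  -- the coefficient of `y²` determines `κ²`, hence `κ` up to sign
  have hκ : κ ^ 2 = d * (p / (N * (p + N))) := by
    obtain ⟨x, hx, -⟩ := h2.exists
    field_simp at hx ⊢
    linear_combination -hx
  have hκ2 : κ ^ 2 = (√(v * p) / (p + N)) ^ 2 := by
    rw [hκ, hd, div_pow, Real.sq_sqrt (by positivity)]
    field_simp
  -- inserting `u` in the constant coefficient leaves `(s - c)² = s²`, impossible for two values of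
  -- `s` unless `c = 0`
  have hc : c = 0 := by
    have h3 : ∀ᵐ x ∂μ, c * (c - 2 * s x) = 0 := by
      filter_upwards [h2] with x hx
      obtain ⟨-, hu, hq⟩ := hx
      have hu' : u x = N * κ * (s x - c) / d := by field_simp at hu ⊢; linarith
      have e : u x ^ 2 / N = (s x - c) ^ 2 * (p / (p + N)) / d := by
        rw [hu', div_pow, mul_pow, mul_pow, hκ]; field_simp
      rw [e, hd] at hq
      field_simp at hq
      have : (p + N - p) * (c * (c - 2 * s x)) = 0 := by linear_combination -hq
      rw [add_sub_cancel_left] at this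
      exact (mul_eq_zero.1 this).resolve_left hN.ne'
    obtain ⟨x, y, hx, hy, hxy⟩ := exists_ne_of_map_eq_gaussianReal hs hv hlaw h3
    by_contra hne
    have hx' := (mul_eq_zero.1 hx).resolve_left hne
    have hy' := (mul_eq_zero.1 hy).resolve_left hne
    exact hxy (by linarith)
  obtain ⟨ε, hε, hκε⟩ : ∃ ε : ℝ, (ε = 1 ∨ ε = -1) ∧ κ = ε * (√(v * p) / (p + N)) := by
    rcases sq_eq_sq_iff_eq_or_eq_neg.1 hκ2 with h | h
    · exact ⟨1, .inl rfl, by rw [h, one_mul]⟩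
    · exact ⟨-1, .inr rfl, by rw [h, neg_one_mul]⟩
  refine ⟨ε, hε, ?_, ?_⟩
  · filter_upwards [h2] with x hx
    obtain ⟨-, hu, -⟩ := hx
    have hu' : u x = N * κ * s x / d := by rw [hc] at hu; field_simp at hu ⊢; linarith
    have hsq : √(p / v) = √(v * p) / v := by
      rw [← Real.sqrt_mul_self (show 0 ≤ √(v * p) / v by positivity), div_mul_div_comm,
        Real.mul_self_sqrt (by positivity)]
      congr 1; field_simp
    rw [hu', hκε, hd, hsq]
    field_simp
  · filter_upwards [hf] with y hy
    rw [hy, hc, hκε]; ring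

end

/-! ### Entropy, conditional expectation and linear estimators -/

lemma log_gaussianPDFReal (m x : ℝ) {v : ℝ} (hv : 0 < v) :
    Real.log (gaussianPDFReal m v.toNNReal x) =
      -(1 / 2 * Real.log (2 * Real.pi * v)) - (x - m) ^ 2 / (2 * v) := by
  rw [gaussianPDFReal, Real.coe_toNNReal _ hv.le, Real.log_mul (by positivity) (by positivity),
    Real.log_exp, Real.log_inv, Real.log_sqrt (by positivity)]
  ring

lemma log_two_pi_exp_mul {v : ℝ} (hv : 0 < v) :
    1 / 2 * Real.log (2 * Real.pi * Real.exp 1 * v) = 1 / 2 * Real.log (2 * Real.pi * v) + 1 / 2 := by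
  have : 2 * Real.pi * Real.exp 1 * v = 2 * Real.pi * v * Real.exp 1 := by ring
  rw [this, Real.log_mul (by positivity) (by positivity), Real.log_exp]
  ring

section
variable {Ω : Type*} [MeasurableSpace Ω] {P : Measure Ω} {A B : Ω → ℝ}

/-- A linear estimator whose residual is independent of the observation is optimal. -/
lemma integral_sq_residual_le_of_indepFun {Y : Ω → ℝ} (c : ℝ)
    (hY2 : MemLp Y 2 P) (hE2 : MemLp (fun ω => A ω - c * Y ω) 2 P)
    (hE0 : ∫ ω, (A ω - c * Y ω) ∂P = 0)
    (hind : IndepFun (fun ω => A ω - c * Y ω) Y P) {f : ℝ → ℝ} (hf : Measurable f)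
    (hf2 : MemLp (fun ω => f (Y ω)) 2 P) :
    ∫ ω, (A ω - c * Y ω) ^ 2 ∂P ≤ ∫ ω, (A ω - f (Y ω)) ^ 2 ∂P := by
  have hG2 : MemLp (fun ω => c * Y ω - f (Y ω)) 2 P := (hY2.const_mul c).sub hf2
  have hcross : ∫ ω, (A ω - c * Y ω) * (c * Y ω - f (Y ω)) ∂P = 0 := by
    have h1 : IndepFun (fun ω => A ω - c * Y ω) (fun ω => c * Y ω - f (Y ω)) P :=
      hind.comp (φ := id) (ψ := fun y => c * y - f y) measurable_id (by fun_prop)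
    have := h1.integral_fun_mul_eq_mul_integral hE2.1 hG2.1
    rw [this, hE0, zero_mul]
  have e : ∀ ω, (A ω - f (Y ω)) ^ 2 = (A ω - c * Y ω) ^ 2 +
      2 * ((A ω - c * Y ω) * (c * Y ω - f (Y ω))) + (c * Y ω - f (Y ω)) ^ 2 := fun ω => by ring
  simp_rw [e]
  have i2 : Integrable (fun ω => 2 * ((A ω - c * Y ω) * (c * Y ω - f (Y ω)))) P :=
    (hE2.integrable_mul hG2).const_mul 2
  have i12 : Integrable (fun ω => (A ω - c * Y ω) ^ 2 +
    2 * ((A ω - c * Y ω) * (c * Y ω - f (Y ω)))) P := hE2.integrable_sq.add i2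
  rw [integral_add i12 hG2.integrable_sq, integral_add hE2.integrable_sq i2, integral_const_mul,
    hcross]
  have := integral_nonneg (μ := P) (f := fun ω => (c * Y ω - f (Y ω)) ^ 2) fun ω => sq_nonneg _
  linarith

variable [IsProbabilityMeasure P]

lemma measurable_gaussianPDF_sub_mul (c D : ℝ) :
    Measurable (fun q : ℝ × ℝ => gaussianPDF (c * q.2) D.toNNReal q.1) := by
  have := measurable_uncurry_gaussianPDF.comp
    (f := fun q : ℝ × ℝ => (c * q.2, D.toNNReal, q.1)) (by fun_prop)
  exact this

lemma integral_log_gaussianPDF (hA : Measurable A) (hB : Measurable B) (c : ℝ) {D : ℝ} (hD : 0 < D)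
    (h2 : MemLp (fun ω => A ω - c * B ω) 2 P) :
    Integrable (fun q : ℝ × ℝ => Real.log (gaussianPDF (c * q.2) D.toNNReal q.1).toReal)
      (P.map (fun ω => (A ω, B ω))) ∧
    ∫ q, Real.log (gaussianPDF (c * q.2) D.toNNReal q.1).toReal ∂(P.map (fun ω => (A ω, B ω))) =
      -(1 / 2 * Real.log (2 * Real.pi * D)) - (∫ ω, (A ω - c * B ω) ^ 2 ∂P) / (2 * D) := by
  have hm : Measurable (fun ω => (A ω, B ω)) := hA.prodMk hB
  simp only [toReal_gaussianPDF, log_gaussianPDFReal _ _ hD]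
  have hi : Integrable (fun ω => (A ω - c * B ω) ^ 2 / (2 * D)) P := h2.integrable_sq.div_const _
  rw [integrable_map_measure (by fun_prop) hm.aemeasurable,
    integral_map hm.aemeasurable (by fun_prop)]
  refine ⟨(integrable_const _).sub hi, ?_⟩
  rw [integral_sub (integrable_const _) hi, integral_div]
  simp

lemma lintegral_gaussianPDF_prod (ν : Measure ℝ) [IsProbabilityMeasure ν] (c : ℝ) {D : ℝ}
    (hD : 0 < D) :
    ∫⁻ q, gaussianPDF (c * q.2) D.toNNReal q.1 ∂((volume : Measure ℝ).prod ν) = 1 := by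
  rw [lintegral_prod_symm _ (measurable_gaussianPDF_sub_mul c D).aemeasurable]
  simp [lintegral_gaussianPDF_eq_one _ (show D.toNNReal ≠ 0 by simpa using hD)]

/-- Gibbs' inequality: with `D` the variance of the reference conditional density `N(c b, D)`,
the conditional entropy is at most `log (2 π D) / 2 + E (A - c B)² / (2 D)`. -/
theorem le_integral_sq_of_le_condDiffEntropy (hA : Measurable A) (hB : Measurable B) {D : ℝ}
    (hD : 0 < D) (c : ℝ) (h2 : MemLp (fun ω => A ω - c * B ω) 2 P)
    (h : ((1 / 2 * Real.log (2 * Real.pi * Real.exp 1 * D) : ℝ) : EReal) ≤ condDiffEntropy P A B) :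
    D ≤ ∫ ω, (A ω - c * B ω) ^ 2 ∂P := by
  have hm : Measurable (fun ω => (A ω, B ω)) := hA.prodMk hB
  have := Measure.isProbabilityMeasure_map (μ := P) hm.aemeasurable
  have := Measure.isProbabilityMeasure_map (μ := P) hB.aemeasurable
  unfold condDiffEntropy at h
  split_ifs at h with hc
  swap
  · exact absurd h (by simp only [le_bot_iff]; exact EReal.coe_ne_bot _)
  obtain ⟨hac, hint⟩ := hc
  rw [EReal.coe_le_coe_iff, log_two_pi_exp_mul hD] at h
  obtain ⟨hi, he⟩ := integral_log_gaussianPDF hA hB c hD h2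
  set J := P.map (fun ω => (A ω, B ω))
  set R := (volume : Measure ℝ).prod (P.map B)
  -- the integrand is the ratio of the Gaussian to the true conditional density; the set where the
  -- true density vanishes does not count, so there is only an inequality
  have hle : ∫⁻ q, ENNReal.ofReal (Real.exp
      (Real.log (gaussianPDF (c * q.2) D.toNNReal q.1).toReal - llr J R q)) ∂J ≤ 1 := by
    rw [← lintegral_gaussianPDF_prod (P.map B) c hD, ← lintegral_rnDeriv_mul hac]
    · refine lintegral_mono_ae ?_
      filter_upwards [J.rnDeriv_lt_top R] with q hq
      rcases eq_or_ne (J.rnDeriv R q) 0 with h0 | h0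
      · simp [h0]
      have hp : 0 < (J.rnDeriv R q).toReal := ENNReal.toReal_pos h0 hq.ne
      have hg : 0 < (gaussianPDF (c * q.2) D.toNNReal q.1).toReal := by
        rw [toReal_gaussianPDF]
        exact gaussianPDFReal_pos _ _ _ (by simpa using hD)
      rw [llr_def, Real.exp_sub, Real.exp_log hp, Real.exp_log hg]
      nth_rw 1 [← ENNReal.ofReal_toReal hq.ne]
      rw [← ENNReal.ofReal_mul hp.le, mul_div_cancel₀ _ hp.ne', ENNReal.ofReal_toReal
        gaussianPDF_ne_top]
    · exact ((Real.measurable_log.comp (measurable_gaussianPDF_sub_mul c D).ennreal_toReal).sub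
        (measurable_llr J R)).exp.ennreal_ofReal.aemeasurable
  have h3 := (integral_nonpos_of_lintegral_exp_le_one (hi.sub hint) hle).1
  have h4 : ∫ q, (Real.log (gaussianPDF (c * q.2) D.toNNReal q.1).toReal - llr J R q) ∂J ≤ 0 := h3
  rw [integral_sub hi hint, he] at h4
  have h5 : 1 / 2 ≤ (∫ ω, (A ω - c * B ω) ^ 2 ∂P) / (2 * D) := by linarith
  rw [div_le_div_iff₀ (by positivity) (by positivity)] at h5
  linarith

/-- If `A - c B` is `N(0, D)` and independent of `B`, then `A` given `B = b` has the law
`N(c b, D)`. -/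
lemma map_eq_withDensity_of_indepFun (hA : Measurable A) (hB : Measurable B) (c : ℝ) {D : ℝ}
    (hD : 0 < D) (hind : IndepFun (fun ω => A ω - c * B ω) B P)
    (hlaw : P.map (fun ω => A ω - c * B ω) = gaussianReal 0 D.toNNReal) :
    P.map (fun ω => (A ω, B ω)) = ((volume : Measure ℝ).prod (P.map B)).withDensity
      (fun q => gaussianPDF (c * q.2) D.toNNReal q.1) := by
  have := Measure.isProbabilityMeasure_map (μ := P) hB.aemeasurable
  have hD' : D.toNNReal ≠ 0 := by simpa using hD
  have hE : Measurable (fun ω => A ω - c * B ω) := by fun_prop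
  have h1 := (indepFun_iff_map_prod_eq_prod_map_map hE.aemeasurable hB.aemeasurable).1 hind
  have h2 : P.map (fun ω => (A ω, B ω)) =
      ((gaussianReal 0 D.toNNReal).prod (P.map B)).map (fun q : ℝ × ℝ => (q.1 + c * q.2, q.2)) := by
    rw [← hlaw, ← h1, Measure.map_map (by fun_prop) (by fun_prop)]
    congr 1; ext ω <;> simp
  refine Measure.ext_of_lintegral _ fun f hf => ?_
  rw [h2, lintegral_map hf (by fun_prop), lintegral_withDensity_eq_lintegral_mul _
    (measurable_gaussianPDF_sub_mul c D) hf, lintegral_prod_symm _ (by fun_prop),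
    lintegral_prod_symm _ ((measurable_gaussianPDF_sub_mul c D).mul hf).aemeasurable]
  refine lintegral_congr fun b => ?_
  rw [gaussianReal_of_var_ne_zero _ hD', lintegral_withDensity_eq_lintegral_mul _
    (measurable_gaussianPDF _ _) (by fun_prop), ←
    lintegral_add_right_eq_self
      (fun a => ((fun q : ℝ × ℝ => gaussianPDF (c * q.2) D.toNNReal q.1) * f) (a, b)) (c * b)]
  refine lintegral_congr fun e => ?_
  simp [gaussianPDF, gaussianPDFReal]

theorem condDiffEntropy_eq_of_indepFun (hA : Measurable A) (hB : Measurable B) (c : ℝ) {D : ℝ}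
    (hD : 0 < D) (hind : IndepFun (fun ω => A ω - c * B ω) B P)
    (hlaw : P.map (fun ω => A ω - c * B ω) = gaussianReal 0 D.toNNReal) :
    condDiffEntropy P A B = ((1 / 2 * Real.log (2 * Real.pi * Real.exp 1 * D) : ℝ) : EReal) := by
  have := Measure.isProbabilityMeasure_map (μ := P) hB.aemeasurable
  have hE : Measurable (fun ω => A ω - c * B ω) := by fun_prop
  have hJ := map_eq_withDensity_of_indepFun hA hB c hD hind hlaw
  obtain ⟨hi, he⟩ := integral_log_gaussianPDF hA hB c hD (memLp_two_of_map_eq hE hlaw)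
  rw [integral_sq_of_map_eq hD.le hE hlaw] at he
  unfold condDiffEntropy
  set J := P.map (fun ω => (A ω, B ω))
  set R := (volume : Measure ℝ).prod (P.map B)
  have hac : J ≪ R := by rw [hJ]; exact withDensity_absolutelyContinuous _ _
  have hllr : (fun q : ℝ × ℝ => Real.log (gaussianPDF (c * q.2) D.toNNReal q.1).toReal)
      =ᵐ[J] llr J R := by
    have h1 := Measure.rnDeriv_withDensity R (measurable_gaussianPDF_sub_mul c D)
    rw [← hJ] at h1
    filter_upwards [hac.ae_le h1] with q hq
    simp only [llr_def, hq]
  rw [if_pos ⟨hac, hi.congr hllr⟩, ← integral_congr_ae hllr, he, log_two_pi_exp_mul hD]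
  congr 1
  field_simp
  ring

/-- The conditional expectation is an optimal estimator. -/
lemma integral_sq_sub_condExp_le {Y : Ω → ℝ} (hY : Measurable Y) (hA2 : MemLp A 2 P)
    {f : ℝ → ℝ} (hf : Measurable f) (hf2 : MemLp (fun ω => f (Y ω)) 2 P) :
    ∫ ω, (A ω - (P[A | MeasurableSpace.comap Y inferInstance]) ω) ^ 2 ∂P ≤
      ∫ ω, (A ω - f (Y ω)) ^ 2 ∂P := by
  set m : MeasurableSpace Ω := MeasurableSpace.comap Y inferInstance
  have hm : m ≤ _ := hY.comap_le
  set C := P[A | m]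
  have hC2 : MemLp C 2 P := hA2.condExp one_le_two
  have hE2 : MemLp (fun ω => A ω - C ω) 2 P := hA2.sub hC2
  have hG2 : MemLp (fun ω => C ω - f (Y ω)) 2 P := hC2.sub hf2
  have hGm : StronglyMeasurable[m] (fun ω => C ω - f (Y ω)) :=
    stronglyMeasurable_condExp.sub
      (hf.comp (comap_measurable Y)).stronglyMeasurable
  have hcross : ∫ ω, (A ω - C ω) * (C ω - f (Y ω)) ∂P = 0 := by
    have h1 := condExp_mul_of_stronglyMeasurable_right (μ := P) (m := m)
      (f := fun ω => A ω - C ω) hGm (hE2.integrable_mul hG2) (hE2.integrable one_le_two)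
    have h2 : P[(fun ω => A ω - C ω) | m] =ᵐ[P] 0 := by
      have h3 := condExp_sub (hA2.integrable one_le_two) (hC2.integrable one_le_two) m
      have h4 : P[C | m] = C := condExp_of_stronglyMeasurable hm stronglyMeasurable_condExp
        (hC2.integrable one_le_two)
      rw [h4] at h3
      refine h3.trans (.of_forall fun ω => ?_)
      simp [C]
    have h5 := integral_condExp (μ := P) (f := (fun ω => A ω - C ω) * fun ω => C ω - f (Y ω)) hm
    rw [integral_congr_ae h1] at h5
    refine h5.symm.trans (integral_eq_zero_of_ae ?_)
    filter_upwards [h2] with ω hω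
    simp only [Pi.mul_apply, hω, Pi.zero_apply, zero_mul]
  have e : ∀ ω, (A ω - f (Y ω)) ^ 2 = (A ω - C ω) ^ 2 +
      2 * ((A ω - C ω) * (C ω - f (Y ω))) + (C ω - f (Y ω)) ^ 2 := fun ω => by ring
  simp_rw [e]
  have i2 : Integrable (fun ω => 2 * ((A ω - C ω) * (C ω - f (Y ω)))) P :=
    (hE2.integrable_mul hG2).const_mul 2
  have i12 : Integrable (fun ω => (A ω - C ω) ^ 2 +
    2 * ((A ω - C ω) * (C ω - f (Y ω)))) P := hE2.integrable_sq.add i2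
  rw [integral_add i12 hG2.integrable_sq, integral_add hE2.integrable_sq i2, integral_const_mul,
    hcross]
  have := integral_nonneg (μ := P) (f := fun ω => (C ω - f (Y ω)) ^ 2) fun ω => sq_nonneg _
  linarith

end

/-! ### Consequences of feasibility -/

@[fun_prop] lemma measurable_srcX : Measurable srcX := by unfold srcX; fun_prop
@[fun_prop] lemma measurable_srcTheta : Measurable srcTheta := by unfold srcTheta; fun_prop
@[fun_prop] lemma measurable_chanOut : Measurable chanOut := by unfold chanOut; fun_prop

section
variable {src : Measure (ℝ × ℝ)} {vX ρ r vZ : ℝ}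

lemma IsSourceLaw.isProbabilityMeasure (hs : IsSourceLaw src vX ρ r) : IsProbabilityMeasure src :=
  have := hs.gaussian
  inferInstance

lemma IsSourceLaw.memLp_fst (hs : IsSourceLaw src vX ρ r) : MemLp (fun p : ℝ × ℝ => p.1) 2 src :=
  have := hs.gaussian
  IsGaussian.memLp_dual src (ContinuousLinearMap.fst ℝ ℝ ℝ) 2 (by simp)

lemma IsSourceLaw.memLp_snd (hs : IsSourceLaw src vX ρ r) : MemLp (fun p : ℝ × ℝ => p.2) 2 src :=
  have := hs.gaussian
  IsGaussian.memLp_dual src (ContinuousLinearMap.snd ℝ ℝ ℝ) 2 (by simp)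

lemma IsSourceLaw.integral_linear (hs : IsSourceLaw src vX ρ r) (a b : ℝ) :
    ∫ p : ℝ × ℝ, (a * p.1 + b * p.2) ∂src = 0 := by
  have := hs.isProbabilityMeasure
  rw [integral_add ((hs.memLp_fst.integrable one_le_two).const_mul a)
    ((hs.memLp_snd.integrable one_le_two).const_mul b), integral_const_mul, integral_const_mul,
    hs.mean_fst, hs.mean_snd]
  simp

lemma IsSourceLaw.integral_mul_linear (hs : IsSourceLaw src vX ρ r) (a b c d : ℝ) :
    ∫ p : ℝ × ℝ, (a * p.1 + b * p.2) * (c * p.1 + d * p.2) ∂src =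
      vX * (a * c + (a * d + b * c) * ρ + b * d * r) := by
  have e : ∀ p : ℝ × ℝ, (a * p.1 + b * p.2) * (c * p.1 + d * p.2) =
      a * c * p.1 ^ 2 + (a * d + b * c) * (p.1 * p.2) + b * d * p.2 ^ 2 := fun p => by ring
  simp_rw [e]
  have i1 : Integrable (fun p : ℝ × ℝ => a * c * p.1 ^ 2) src :=
    hs.memLp_fst.integrable_sq.const_mul _
  have i2 : Integrable (fun p : ℝ × ℝ => (a * d + b * c) * (p.1 * p.2)) src :=
    (hs.memLp_fst.integrable_mul hs.memLp_snd).const_mul _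
  have i3 : Integrable (fun p : ℝ × ℝ => b * d * p.2 ^ 2) src :=
    hs.memLp_snd.integrable_sq.const_mul _
  have i12 : Integrable (fun p : ℝ × ℝ => a * c * p.1 ^ 2 + (a * d + b * c) * (p.1 * p.2)) src :=
    i1.add i2
  rw [integral_add i12 i3, integral_add i1 i2, integral_const_mul, integral_const_mul,
    integral_const_mul, hs.var_fst, hs.cov, hs.var_snd]
  ring

/-- Each `X + a θ` is a centered Gaussian variable. -/
lemma IsSourceLaw.map_add_mul (hs : IsSourceLaw src vX ρ r) (a : ℝ) :
    src.map (fun p : ℝ × ℝ => p.1 + a * p.2) =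
      gaussianReal 0 (vX * (1 + 2 * a * ρ + a ^ 2 * r)).toNNReal := by
  have := hs.gaussian
  let L : (ℝ × ℝ) →L[ℝ] ℝ := ContinuousLinearMap.fst ℝ ℝ ℝ + a • ContinuousLinearMap.snd ℝ ℝ ℝ
  have hL : (fun p : ℝ × ℝ => p.1 + a * p.2) = L := by ext p; simp [L]
  have h0 : ∫ p : ℝ × ℝ, L p ∂src = 0 := by
    rw [← hL]; simpa using hs.integral_linear 1 a
  have h1 := IsGaussian.map_eq_gaussianReal (μ := src) L
  rw [hL, h1, h0, variance_of_integral_eq_zero (by fun_prop) h0, ← hL]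
  congr 2
  have := hs.integral_mul_linear 1 a 1 a
  simp only [one_mul, ← pow_two] at this
  rw [this]
  ring

variable {g : Kernel (ℝ × ℝ) ℝ}

lemma isProbabilityMeasure_systemLaw [IsProbabilityMeasure src] [IsMarkovKernel g] :
    IsProbabilityMeasure (systemLaw src vZ g) := by
  unfold systemLaw; infer_instance

lemma measurePreserving_source [IsProbabilityMeasure src] [IsMarkovKernel g] :
    MeasurePreserving (fun ω : Outcome => ω.1.1) (systemLaw src vZ g) src := by
  have h1 : MeasurePreserving (Prod.fst : (ℝ × ℝ) × ℝ → ℝ × ℝ) (src.compProd g) src :=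
    ⟨measurable_fst, Measure.fst_compProd src g⟩
  exact h1.comp measurePreserving_fst

lemma memLp_srcX [IsMarkovKernel g] (hs : IsSourceLaw src vX ρ r) :
    MemLp srcX 2 (systemLaw src vZ g) :=
  have := hs.isProbabilityMeasure
  hs.memLp_fst.comp_measurePreserving measurePreserving_source

lemma memLp_srcTheta [IsMarkovKernel g] (hs : IsSourceLaw src vX ρ r) :
    MemLp srcTheta 2 (systemLaw src vZ g) :=
  have := hs.isProbabilityMeasure
  hs.memLp_snd.comp_measurePreserving measurePreserving_source

lemma integral_mul_linear_source [IsMarkovKernel g] (hs : IsSourceLaw src vX ρ r) (a b c d : ℝ) :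
    ∫ ω, (a * srcX ω + b * srcTheta ω) * (c * srcX ω + d * srcTheta ω) ∂(systemLaw src vZ g) =
      vX * (a * c + (a * d + b * c) * ρ + b * d * r) := by
  have := hs.isProbabilityMeasure
  have h := integral_map (μ := systemLaw src vZ g) (φ := fun ω : Outcome => ω.1.1)
    (f := fun p : ℝ × ℝ => (a * p.1 + b * p.2) * (c * p.1 + d * p.2)) (by fun_prop) (by fun_prop)
  rw [measurePreserving_source.map_eq, hs.integral_mul_linear] at h
  exact h.symm

lemma integral_sq_linear_sub [IsMarkovKernel g] (hs : IsSourceLaw src vX ρ r) {h : ℝ → ℝ}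
    (hh : MemLp (fun ω => h (chanOut ω)) 2 (systemLaw src vZ g)) (a b k : ℝ) :
    ∫ ω, (a * srcX ω + b * srcTheta ω - k * h (chanOut ω)) ^ 2 ∂(systemLaw src vZ g) =
      vX * (a ^ 2 + 2 * a * b * ρ + b ^ 2 * r) -
        2 * k * (a * ∫ ω, srcX ω * h (chanOut ω) ∂(systemLaw src vZ g) +
          b * ∫ ω, srcTheta ω * h (chanOut ω) ∂(systemLaw src vZ g)) +
        k ^ 2 * ∫ ω, h (chanOut ω) ^ 2 ∂(systemLaw src vZ g) := by
  set P := systemLaw src vZ g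
  have hX : MemLp srcX 2 P := memLp_srcX hs
  have hT : MemLp srcTheta 2 P := memLp_srcTheta hs
  have e : ∀ ω, (a * srcX ω + b * srcTheta ω - k * h (chanOut ω)) ^ 2 =
      (a * srcX ω + b * srcTheta ω) * (a * srcX ω + b * srcTheta ω) -
      (2 * k * a * (srcX ω * h (chanOut ω)) + 2 * k * b * (srcTheta ω * h (chanOut ω))) +
      k ^ 2 * h (chanOut ω) ^ 2 := fun ω => by ring
  simp_rw [e]
  have hS : MemLp (fun ω => a * srcX ω + b * srcTheta ω) 2 P := (hX.const_mul a).add (hT.const_mul b)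
  have i0 : Integrable (fun ω => (a * srcX ω + b * srcTheta ω) * (a * srcX ω + b * srcTheta ω)) P :=
    hS.integrable_mul hS
  have i1 : Integrable (fun ω => 2 * k * a * (srcX ω * h (chanOut ω))) P :=
    (hX.integrable_mul hh).const_mul _
  have i2 : Integrable (fun ω => 2 * k * b * (srcTheta ω * h (chanOut ω))) P :=
    (hT.integrable_mul hh).const_mul _
  have i3 : Integrable (fun ω => k ^ 2 * h (chanOut ω) ^ 2) P := hh.integrable_sq.const_mul _
  have i12 : Integrable (fun ω => 2 * k * a * (srcX ω * h (chanOut ω)) +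
    2 * k * b * (srcTheta ω * h (chanOut ω))) P := i1.add i2
  have i012 : Integrable (fun ω => (a * srcX ω + b * srcTheta ω) * (a * srcX ω + b * srcTheta ω) -
      (2 * k * a * (srcX ω * h (chanOut ω)) + 2 * k * b * (srcTheta ω * h (chanOut ω)))) P :=
    i0.sub i12
  rw [integral_add i012 i3, integral_sub i0 i12, integral_add i1 i2, integral_const_mul,
    integral_const_mul, integral_const_mul, integral_mul_linear_source hs]
  ring

/-- Orthogonality for a best response, tested against rescalings of the decoder only. -/
lemma IsBestResponse.integral_mul_eq [IsMarkovKernel g] (hs : IsSourceLaw src vX ρ r) {h : ℝ → ℝ}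
    (hb : IsBestResponse (systemLaw src vZ g) h) :
    ∫ ω, srcX ω * h (chanOut ω) ∂(systemLaw src vZ g) =
      ∫ ω, h (chanOut ω) ^ 2 ∂(systemLaw src vZ g) := by
  obtain ⟨⟨hm, h2⟩, hmin⟩ := hb
  have key : ∀ k : ℝ, ∫ ω, (srcX ω - 1 * h (chanOut ω)) ^ 2 ∂(systemLaw src vZ g) ≤
      ∫ ω, (srcX ω - k * h (chanOut ω)) ^ 2 ∂(systemLaw src vZ g) := by
    intro k
    have := hmin (fun y => k * h y) ⟨by fun_prop, h2.const_mul k⟩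
    simpa [distortion] using this
  have e : ∀ k : ℝ, ∫ ω, (srcX ω - k * h (chanOut ω)) ^ 2 ∂(systemLaw src vZ g) =
      vX - 2 * k * ∫ ω, srcX ω * h (chanOut ω) ∂(systemLaw src vZ g) +
        k ^ 2 * ∫ ω, h (chanOut ω) ^ 2 ∂(systemLaw src vZ g) := by
    intro k
    have := integral_sq_linear_sub hs h2 1 0 k
    simpa using this
  simp_rw [e] at key
  set A := ∫ ω, srcX ω * h (chanOut ω) ∂(systemLaw src vZ g)
  set m := ∫ ω, h (chanOut ω) ^ 2 ∂(systemLaw src vZ g)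
  have hm0 : 0 ≤ m := integral_nonneg fun ω => sq_nonneg _
  -- the quadratic `k ↦ k² m - 2 k A` is minimal at `k = 1`
  -- the denominator `m + 1` also covers `m = 0`
  have h3 := key (1 + (A - m) / (m + 1))
  have h4 : (A - m) ^ 2 * (m + 2) ≤ 0 := by
    have h5 : 0 ≤ (m + 1) ^ 2 * ((vX - 2 * (1 + (A - m) / (m + 1)) * A +
        (1 + (A - m) / (m + 1)) ^ 2 * m) - (vX - 2 * 1 * A + 1 ^ 2 * m)) :=
      mul_nonneg (by positivity) (by linarith)
    have h6 : (m + 1) ^ 2 * ((vX - 2 * (1 + (A - m) / (m + 1)) * A +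
        (1 + (A - m) / (m + 1)) ^ 2 * m) - (vX - 2 * 1 * A + 1 ^ 2 * m)) =
        -((A - m) ^ 2 * (m + 2)) := by
      field_simp; ring
    linarith
  have h7 : (A - m) ^ 2 = 0 := by nlinarith [sq_nonneg (A - m), mul_nonneg (sq_nonneg (A - m)) hm0]
  linarith [pow_eq_zero_iff (two_ne_zero) |>.1 h7]

lemma IsBestResponse.distortion_eq [IsMarkovKernel g] (hs : IsSourceLaw src vX ρ r) {h : ℝ → ℝ}
    (hb : IsBestResponse (systemLaw src vZ g) h) :
    distortion (systemLaw src vZ g) h = vX - ∫ ω, h (chanOut ω) ^ 2 ∂(systemLaw src vZ g) := by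
  have := integral_sq_linear_sub hs hb.1.2 1 0 1
  simp only [one_mul, zero_mul, add_zero, hb.integral_mul_eq hs] at this
  rw [distortion, this]; ring

/-- The converse for the scalar source `X + a θ` and the decoder `k h`, with the optimal
`k = (m + a n) / m`, where `m = E h(Y)²` and `n = E θ h(Y)`. In case of equality the encoder and the
decoder are linear. -/
theorem IsFeasible.sq_le {PT : ℝ} {priv : PrivacyConstraint} {h : ℝ → ℝ}
    (hs : IsSourceLaw src vX ρ r) (hvX : 0 < vX) (hvZ : 0 < vZ) (hPT : 0 < PT)
    (hf : IsFeasible src vZ PT priv g h) {a : ℝ} (hV : 0 < 1 + 2 * a * ρ + a ^ 2 * r)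
    (hm : 0 < ∫ ω, h (chanOut ω) ^ 2 ∂(systemLaw src vZ g)) :
    (∫ ω, h (chanOut ω) ^ 2 ∂(systemLaw src vZ g) +
        a * ∫ ω, srcTheta ω * h (chanOut ω) ∂(systemLaw src vZ g)) ^ 2 ≤
      PT / (PT + vZ) * (vX * (1 + 2 * a * ρ + a ^ 2 * r)) *
        ∫ ω, h (chanOut ω) ^ 2 ∂(systemLaw src vZ g) ∧
    (PT / (PT + vZ) * (vX * (1 + 2 * a * ρ + a ^ 2 * r)) *
        ∫ ω, h (chanOut ω) ^ 2 ∂(systemLaw src vZ g) ≤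
      (∫ ω, h (chanOut ω) ^ 2 ∂(systemLaw src vZ g) +
        a * ∫ ω, srcTheta ω * h (chanOut ω) ∂(systemLaw src vZ g)) ^ 2 →
      ∃ ε : ℝ, (ε = 1 ∨ ε = -1) ∧
        (∀ᵐ p ∂src, g p = Measure.dirac
          (ε * (√(PT / (vX * (1 + 2 * a * ρ + a ^ 2 * r))) * (p.1 + a * p.2)))) ∧
        (∀ᵐ y : ℝ, (∫ ω, h (chanOut ω) ^ 2 ∂(systemLaw src vZ g) +
        a * ∫ ω, srcTheta ω * h (chanOut ω) ∂(systemLaw src vZ g)) /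
          (∫ ω, h (chanOut ω) ^ 2 ∂(systemLaw src vZ g)) * h y =
          ε * (√(vX * (1 + 2 * a * ρ + a ^ 2 * r) * PT) / (PT + vZ) * y))) := by
  have := hs.isProbabilityMeasure
  have := hf.markov
  have hb := hf.response
  have hA := hb.integral_mul_eq hs
  have hsq := fun k => integral_sq_linear_sub hs hb.1.2 1 a k
  rw [hA] at hsq
  set m := ∫ ω, h (chanOut ω) ^ 2 ∂(systemLaw src vZ g)
  set n := ∫ ω, srcTheta ω * h (chanOut ω) ∂(systemLaw src vZ g)
  set V := 1 + 2 * a * ρ + a ^ 2 * r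
  set k := (m + a * n) / m
  have hv : 0 < vX * V := by positivity
  let s : (ℝ × ℝ) × ℝ → ℝ := fun q => q.1.1 + a * q.1.2
  let u : (ℝ × ℝ) × ℝ → ℝ := fun q => q.2
  have hsm : Measurable s := by fun_prop
  have hum : Measurable u := by fun_prop
  have hlaw : (src.compProd g).map s = gaussianReal 0 (vX * V).toNNReal := by
    have h := Measure.map_map (μ := src.compProd g) (f := Prod.fst)
      (g := fun p : ℝ × ℝ => p.1 + a * p.2) (by fun_prop) measurable_fst
    rw [← Measure.fst, Measure.fst_compProd, hs.map_add_mul a] at h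
    exact h.symm
  have hfst : MeasurePreserving (Prod.fst : Outcome → (ℝ × ℝ) × ℝ) (systemLaw src vZ g)
    (src.compProd g) := measurePreserving_fst
  have hu2 : MemLp u 2 (src.compProd g) := by
    rw [← hfst.map_eq, memLp_map_measure_iff (by fun_prop) (by fun_prop)]
    exact hf.sq_integrable
  have hup : ∫ q, u q ^ 2 ∂(src.compProd g) ≤ PT := by
    rw [← hfst.map_eq, integral_map (by fun_prop) (by fun_prop)]
    exact hf.power
  have hkm : Measurable (fun y => k * h y) := hb.1.1.const_mul k
  obtain ⟨h1, h2⟩ := le_integral_sq_sub (d := vX * V * vZ / (PT + vZ)) hsm hum hkm hv hvZ hPT rfl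
    hlaw hu2 hup (hb.1.2.const_mul k)
  have h3 : ∫ ω, (s ω.1 - k * h (u ω.1 + ω.2)) ^ 2
      ∂((src.compProd g).prod (gaussianReal 0 vZ.toNNReal)) =
      vX * V - (m + a * n) ^ 2 / m := by
    have := hsq k
    simp only [one_mul, one_pow, mul_one] at this
    rw [show vX * V - (m + a * n) ^ 2 / m = vX * V - 2 * k * (m + a * n) + k ^ 2 * m by
      simp only [k]; field_simp; ring]
    exact this
  rw [h3] at h1 h2
  have h4 : vX * V * vZ / (PT + vZ) = vX * V - PT / (PT + vZ) * (vX * V) := by field_simp; ring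
  rw [h4] at h1 h2
  refine ⟨?_, fun hle => ?_⟩
  · have : (m + a * n) ^ 2 / m ≤ PT / (PT + vZ) * (vX * V) := by linarith
    rwa [div_le_iff₀ hm] at this
  · rw [← le_div_iff₀ hm] at hle
    obtain ⟨ε, hε, hu, hy⟩ := eq_linear_of_logRatio_eq_zero hsm hv hvZ hPT h4.symm hlaw
      (h2 (by linarith))
    refine ⟨ε, hε, ?_, hy⟩
    filter_upwards [Measure.ae_ae_of_ae_compProd hu] with p hp
    have hid : (g p).map id = (g p).map (fun _ => ε * (√(PT / (vX * V)) * (p.1 + a * p.2))) :=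
      Measure.map_congr hp
    rw [Measure.map_id, Measure.map_const] at hid
    simpa using hid

/-- Either form of privacy implies `D_P ≤ E (θ - c h(Y))²` for all `c`; the optimal `c` gives a
bound on the correlation of `θ` and `h(Y)`. -/
lemma sq_integral_mul_le_of_privacy {DP : ℝ} {priv : PrivacyConstraint} {h : ℝ → ℝ}
    (hpriv : priv = entropyPrivacy DP ∨ priv = mmsePrivacy DP) (hDP : 0 < DP) [IsMarkovKernel g]
    (hs : IsSourceLaw src vX ρ r) (hb : IsBestResponse (systemLaw src vZ g) h)
    (hp : priv (systemLaw src vZ g) h)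
    (hm : 0 < ∫ ω, h (chanOut ω) ^ 2 ∂(systemLaw src vZ g)) :
    (∫ ω, srcTheta ω * h (chanOut ω) ∂(systemLaw src vZ g)) ^ 2 ≤
      (vX * r - DP) * ∫ ω, h (chanOut ω) ^ 2 ∂(systemLaw src vZ g) := by
  have := hs.isProbabilityMeasure
  have : IsProbabilityMeasure (systemLaw src vZ g) := isProbabilityMeasure_systemLaw
  have hT : MemLp srcTheta 2 (systemLaw src vZ g) := memLp_srcTheta hs
  have key : ∀ c : ℝ, DP ≤ ∫ ω, (srcTheta ω - c * h (chanOut ω)) ^ 2 ∂(systemLaw src vZ g) := by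
    intro c
    rcases hpriv with rfl | rfl
    · exact le_integral_sq_of_le_condDiffEntropy measurable_srcTheta (hb.1.1.comp measurable_chanOut)
        hDP c (hT.sub (hb.1.2.const_mul c)) hp
    · exact le_trans hp (integral_sq_sub_condExp_le measurable_chanOut hT (hb.1.1.const_mul c)
        (hb.1.2.const_mul c))
  have hsq := fun k => integral_sq_linear_sub hs hb.1.2 0 1 k
  simp only [zero_mul, one_mul, zero_add] at hsq
  simp_rw [hsq] at key
  set m := ∫ ω, h (chanOut ω) ^ 2 ∂(systemLaw src vZ g)
  set n := ∫ ω, srcTheta ω * h (chanOut ω) ∂(systemLaw src vZ g)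
  have h1 := key (n / m)
  have h2 : n ^ 2 / m ≤ vX * r - DP := by
    have : n ^ 2 / m = 2 * (n / m) * n - (n / m) ^ 2 * m := by field_simp; ring
    rw [this]
    linarith
  rwa [div_le_iff₀ hm] at h2

end

/-! ### The linear encoder -/

section
variable {src : Measure (ℝ × ℝ)} {vX ρ r vZ : ℝ}

instance isMarkovKernel_linearEncoder (β α : ℝ) : IsMarkovKernel (linearEncoder β α) := by
  unfold linearEncoder; infer_instance

/-- The linear map that sends `((X, θ), Z)` to the outcome `(((X, θ), U), Z)` of the encoder
`U = β (X + α θ)`. -/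
def linearScheme (β α : ℝ) : (ℝ × ℝ) × ℝ →L[ℝ] Outcome :=
  let p := ContinuousLinearMap.fst ℝ (ℝ × ℝ) ℝ
  let z := ContinuousLinearMap.snd ℝ (ℝ × ℝ) ℝ
  let x := (ContinuousLinearMap.fst ℝ ℝ ℝ).comp p
  let t := (ContinuousLinearMap.snd ℝ ℝ ℝ).comp p
  (p.prod (β • (x + α • t))).prod z

lemma linearScheme_apply (β α : ℝ) (q : (ℝ × ℝ) × ℝ) :
    linearScheme β α q = ((q.1, β * (q.1.1 + α * q.1.2)), q.2) := rfl

lemma systemLaw_linearEncoder [IsProbabilityMeasure src] (β α : ℝ) :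
    systemLaw src vZ (linearEncoder β α) =
      (src.prod (gaussianReal 0 vZ.toNNReal)).map (linearScheme β α) := by
  rw [systemLaw, linearEncoder, Measure.compProd_deterministic]
  have h := Measure.map_prod_map src (gaussianReal 0 vZ.toNNReal)
    (f := fun p : ℝ × ℝ => (p, β * (p.1 + α * p.2))) (g := id) (by fun_prop) measurable_id
  rw [Measure.map_id] at h
  exact h

lemma isGaussian_systemLaw_linearEncoder (hs : IsSourceLaw src vX ρ r) (β α : ℝ) :
    IsGaussian (systemLaw src vZ (linearEncoder β α)) := by
  have := hs.gaussian
  rw [systemLaw_linearEncoder]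
  infer_instance

lemma memLp_chanOut_linearEncoder (hs : IsSourceLaw src vX ρ r) (β α : ℝ) :
    MemLp chanOut 2 (systemLaw src vZ (linearEncoder β α)) := by
  have := isGaussian_systemLaw_linearEncoder (vZ := vZ) hs β α
  exact IsGaussian.memLp_dual _ ((ContinuousLinearMap.snd ℝ (ℝ × ℝ) ℝ).comp
    (ContinuousLinearMap.fst ℝ ((ℝ × ℝ) × ℝ) ℝ) + ContinuousLinearMap.snd ℝ ((ℝ × ℝ) × ℝ) ℝ)
    2 (by simp)

lemma memLp_chanIn_linearEncoder (hs : IsSourceLaw src vX ρ r) (β α : ℝ) :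
    MemLp chanIn 2 (systemLaw src vZ (linearEncoder β α)) := by
  have := isGaussian_systemLaw_linearEncoder (vZ := vZ) hs β α
  exact IsGaussian.memLp_dual _ ((ContinuousLinearMap.snd ℝ (ℝ × ℝ) ℝ).comp
    (ContinuousLinearMap.fst ℝ ((ℝ × ℝ) × ℝ) ℝ)) 2 (by simp)

/-- Covariance of two linear combinations of `X`, `θ` and `Y` under the linear encoder. -/
lemma integral_quadratic_linearEncoder (hs : IsSourceLaw src vX ρ r) (hvZ : 0 ≤ vZ) (β α a b e : ℝ)
    (a' b' e' : ℝ) :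
    ∫ ω, (a * srcX ω + b * srcTheta ω + e * chanOut ω) *
        (a' * srcX ω + b' * srcTheta ω + e' * chanOut ω) ∂(systemLaw src vZ (linearEncoder β α)) =
      vX * ((a + e * β) * (a' + e' * β) +
        ((a + e * β) * (b' + e' * β * α) + (b + e * β * α) * (a' + e' * β)) * ρ +
        (b + e * β * α) * (b' + e' * β * α) * r) + e * e' * vZ := by
  have := hs.isProbabilityMeasure
  rw [systemLaw_linearEncoder, integral_map (by fun_prop) (by fun_prop),
    ← hs.integral_mul_linear]
  set γ := gaussianReal 0 vZ.toNNReal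
  have hz : MemLp (fun q : (ℝ × ℝ) × ℝ => q.2) 2 (src.prod γ) :=
    (memLp_two_gaussianReal 0 _).comp_snd src
  let S : ℝ × ℝ → ℝ := fun p => (a + e * β) * p.1 + (b + e * β * α) * p.2
  let S' : ℝ × ℝ → ℝ := fun p => (a' + e' * β) * p.1 + (b' + e' * β * α) * p.2
  have hS2 : MemLp (fun q : (ℝ × ℝ) × ℝ => S q.1) 2 (src.prod γ) :=
    ((hs.memLp_fst.const_mul _).add (hs.memLp_snd.const_mul _)).comp_fst γ
  have hS2' : MemLp (fun q : (ℝ × ℝ) × ℝ => S' q.1) 2 (src.prod γ) :=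
    ((hs.memLp_fst.const_mul _).add (hs.memLp_snd.const_mul _)).comp_fst γ
  have h : ∀ q : (ℝ × ℝ) × ℝ, (a * srcX (linearScheme β α q) + b * srcTheta (linearScheme β α q)
      + e * chanOut (linearScheme β α q)) * (a' * srcX (linearScheme β α q) +
        b' * srcTheta (linearScheme β α q) + e' * chanOut (linearScheme β α q)) =
      S q.1 * S' q.1 + (e' * (S q.1 * q.2) + e * (S' q.1 * q.2)) + e * e' * q.2 ^ 2 := by
    intro q
    simp only [srcX, srcTheta, chanOut, linearScheme_apply, S, S']
    ring
  simp_rw [h]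
  have i0 : Integrable (fun q : (ℝ × ℝ) × ℝ => S q.1 * S' q.1) (src.prod γ) :=
    hS2.integrable_mul hS2'
  have i1 : Integrable (fun q : (ℝ × ℝ) × ℝ => e' * (S q.1 * q.2)) (src.prod γ) :=
    (hS2.integrable_mul hz).const_mul _
  have i2 : Integrable (fun q : (ℝ × ℝ) × ℝ => e * (S' q.1 * q.2)) (src.prod γ) :=
    (hS2'.integrable_mul hz).const_mul _
  have i3 : Integrable (fun q : (ℝ × ℝ) × ℝ => e * e' * q.2 ^ 2) (src.prod γ) :=
    hz.integrable_sq.const_mul _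
  have i12 : Integrable (fun q : (ℝ × ℝ) × ℝ => e' * (S q.1 * q.2) + e * (S' q.1 * q.2))
    (src.prod γ) := i1.add i2
  have i012 : Integrable (fun q : (ℝ × ℝ) × ℝ => S q.1 * S' q.1 +
    (e' * (S q.1 * q.2) + e * (S' q.1 * q.2))) (src.prod γ) := i0.add i12
  rw [integral_add i012 i3, integral_add i0 i12, integral_add i1 i2, integral_const_mul,
    integral_const_mul, integral_const_mul, integral_prod_mul S (fun x : ℝ => x),
    integral_prod_mul S' (fun x : ℝ => x), integral_id_gaussianReal,
    integral_fun_fst (fun p => S p * S' p), integral_fun_snd (fun x : ℝ => x ^ 2),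
    integral_sq_gaussianReal hvZ]
  simp [S, S']

lemma integral_linear_linearEncoder (hs : IsSourceLaw src vX ρ r) (β α a b e : ℝ) :
    ∫ ω, (a * srcX ω + b * srcTheta ω + e * chanOut ω) ∂(systemLaw src vZ (linearEncoder β α)) =
      0 := by
  have := hs.isProbabilityMeasure
  rw [systemLaw_linearEncoder, integral_map (by fun_prop) (by fun_prop)]
  have h : ∀ q : (ℝ × ℝ) × ℝ, a * srcX (linearScheme β α q) + b * srcTheta (linearScheme β α q)
      + e * chanOut (linearScheme β α q) =
      ((a + e * β) * q.1.1 + (b + e * β * α) * q.1.2) + e * q.2 := by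
    intro q
    simp only [srcX, srcTheta, chanOut, linearScheme_apply]
    ring
  simp_rw [h]
  set γ := gaussianReal 0 vZ.toNNReal
  have hz : MemLp (fun q : (ℝ × ℝ) × ℝ => q.2) 2 (src.prod γ) :=
    (memLp_two_gaussianReal 0 _).comp_snd src
  have hS2 : MemLp (fun q : (ℝ × ℝ) × ℝ => (a + e * β) * q.1.1 + (b + e * β * α) * q.1.2) 2
    (src.prod γ) :=
    ((hs.memLp_fst.const_mul (a + e * β)).add (hs.memLp_snd.const_mul (b + e * β * α))).comp_fst γ
  rw [integral_add (hS2.integrable one_le_two) ((hz.integrable one_le_two).const_mul e),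
    integral_const_mul, integral_fun_fst (fun p : ℝ × ℝ => (a + e * β) * p.1 + (b + e * β * α) * p.2),
    integral_fun_snd (fun x : ℝ => x), integral_id_gaussianReal, hs.integral_linear]
  simp

/-- Under the linear encoder the residual of a regression on `Y` is Gaussian and independent of
`Y`. -/
lemma linearEncoder_residual (hs : IsSourceLaw src vX ρ r) (β α a b c : ℝ)
    (hc : ∫ ω, (a * srcX ω + b * srcTheta ω - c * chanOut ω) * chanOut ω
      ∂(systemLaw src vZ (linearEncoder β α)) = 0) :
    MemLp (fun ω => a * srcX ω + b * srcTheta ω - c * chanOut ω) 2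
      (systemLaw src vZ (linearEncoder β α)) ∧
    ∫ ω, (a * srcX ω + b * srcTheta ω - c * chanOut ω) ∂(systemLaw src vZ (linearEncoder β α)) = 0 ∧
    IndepFun (fun ω => a * srcX ω + b * srcTheta ω - c * chanOut ω) chanOut
      (systemLaw src vZ (linearEncoder β α)) ∧
    (systemLaw src vZ (linearEncoder β α)).map
        (fun ω => a * srcX ω + b * srcTheta ω - c * chanOut ω) =
      gaussianReal 0 (∫ ω, (a * srcX ω + b * srcTheta ω - c * chanOut ω) ^ 2
        ∂(systemLaw src vZ (linearEncoder β α))).toNNReal := by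
  have := hs.isProbabilityMeasure
  have := isGaussian_systemLaw_linearEncoder (vZ := vZ) hs β α
  have h0 := integral_linear_linearEncoder (vZ := vZ) hs β α a b (-c)
  have h0' := integral_linear_linearEncoder (vZ := vZ) hs β α 0 0 1
  set P := systemLaw src vZ (linearEncoder β α)
  simp only [neg_mul, ← sub_eq_add_neg] at h0
  simp only [zero_mul, zero_add, one_mul] at h0'
  let q := ContinuousLinearMap.fst ℝ ((ℝ × ℝ) × ℝ) ℝ
  let p := (ContinuousLinearMap.fst ℝ (ℝ × ℝ) ℝ).comp q
  let Y : Outcome →L[ℝ] ℝ := (ContinuousLinearMap.snd ℝ (ℝ × ℝ) ℝ).comp q +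
    ContinuousLinearMap.snd ℝ ((ℝ × ℝ) × ℝ) ℝ
  let E : Outcome →L[ℝ] ℝ := a • (ContinuousLinearMap.fst ℝ ℝ ℝ).comp p +
    b • (ContinuousLinearMap.snd ℝ ℝ ℝ).comp p - c • Y
  have hlaw : HasGaussianLaw (fun ω => (E ω, Y ω)) P :=
    (IsGaussian.hasGaussianLaw_id (μ := P)).map_fun (E.prod Y)
  have hE2 : MemLp E 2 P := hlaw.fst.memLp_two
  have hY2 : MemLp Y 2 P := hlaw.snd.memLp_two
  refine ⟨hE2, h0, hlaw.indepFun_of_covariance_eq_zero ?_, ?_⟩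
  · rw [covariance_eq_sub hE2 hY2]
    have e1 : ∫ ω, Y ω ∂P = 0 := h0'
    have e2 : ∫ ω, ((E : Outcome → ℝ) * (Y : Outcome → ℝ)) ω ∂P = 0 := hc
    rw [e1, e2]; simp
  · have h3 := hlaw.fst.map_eq_gaussianReal
    have e1 : ∫ ω, E ω ∂P = 0 := h0
    rw [variance_of_integral_eq_zero (by fun_prop) e1, e1] at h3
    exact h3

end

/-! ### Parameters and optimization -/

section
variable {src : Measure (ℝ × ℝ)} {vX ρ r vZ PT DP α β κ : ℝ}

lemma sq_gain (hvX : 0 < vX) (hPT : 0 < PT) (hV : 0 < 1 + 2 * α * ρ + α ^ 2 * r) :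
    gain vX ρ r PT α ^ 2 * (vX * (1 + 2 * α * ρ + α ^ 2 * r)) = PT := by
  rw [gain, Real.sq_sqrt (by positivity)]
  field_simp

lemma gain_pos (hvX : 0 < vX) (hPT : 0 < PT) (hV : 0 < 1 + 2 * α * ρ + α ^ 2 * r) :
    0 < gain vX ρ r PT α := by
  rw [gain]; positivity

lemma slope_eq (hvX : 0 < vX) (hvZ : 0 < vZ) (hPT : 0 < PT)
    (hV : 0 < 1 + 2 * α * ρ + α ^ 2 * r) :
    slope vX ρ r vZ PT α = gain vX ρ r PT α * vX * (1 + α * ρ) / (PT + vZ) := by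
  have h1 := gain_pos hvX hPT hV
  have h2 := sq_gain hvX hPT hV
  rw [slope, show 1 + α ^ 2 * r + 2 * α * ρ = 1 + 2 * α * ρ + α ^ 2 * r by ring]
  set b := gain vX ρ r PT α
  set V := 1 + 2 * α * ρ + α ^ 2 * r
  field_simp
  linear_combination -(1 + α * ρ) * h2

lemma slope_pos (hvX : 0 < vX) (hvZ : 0 < vZ) (hPT : 0 < PT)
    (hV : 0 < 1 + 2 * α * ρ + α ^ 2 * r) (hα : 0 < 1 + α * ρ) : 0 < slope vX ρ r vZ PT α := by
  rw [slope_eq hvX hvZ hPT hV]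
  have := gain_pos hvX hPT hV
  positivity

/-- The coefficient `c` of the regression of `a X + b θ` on `Y` under the linear encoder of power
`PT`, and the resulting mean squared error. -/
lemma linearEncoder_regression (hs : IsSourceLaw src vX ρ r) (hvX : 0 < vX) (hvZ : 0 < vZ)
    (hPT : 0 < PT) (hV : 0 < 1 + 2 * α * ρ + α ^ 2 * r) (hβ : β = gain vX ρ r PT α) (a b c : ℝ)
    (hc : c = β * vX * (a * (1 + α * ρ) + b * (ρ + α * r)) / (PT + vZ)) :
    ∫ ω, (a * srcX ω + b * srcTheta ω - c * chanOut ω) * chanOut ω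
      ∂(systemLaw src vZ (linearEncoder β α)) = 0 ∧
    ∫ ω, (a * srcX ω + b * srcTheta ω - c * chanOut ω) ^ 2
      ∂(systemLaw src vZ (linearEncoder β α)) = vX * (a ^ 2 + 2 * a * b * ρ + b ^ 2 * r) -
        PT / (PT + vZ) * vX * (a * (1 + α * ρ) + b * (ρ + α * r)) ^ 2 /
          (1 + 2 * α * ρ + α ^ 2 * r) := by
  have h2 := sq_gain hvX hPT hV
  rw [← hβ] at h2
  have e1 := integral_quadratic_linearEncoder hs hvZ.le β α a b (-c) 0 0 1
  have e2 := integral_quadratic_linearEncoder hs hvZ.le β α a b (-c) a b (-c)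
  simp only [neg_mul, ← sub_eq_add_neg, zero_mul, zero_add, one_mul, ← pow_two] at e1 e2
  have hcc : c * (PT + vZ) = β * vX * (a * (1 + α * ρ) + b * (ρ + α * r)) := by
    rw [hc]; field_simp
  rw [e1, e2]
  constructor
  · linear_combination -hcc - c * h2
  · set V := 1 + 2 * α * ρ + α ^ 2 * r with hVdef
    set w := a * (1 + α * ρ) + b * (ρ + α * r) with hw
    have h3 : PT / (PT + vZ) * vX * w ^ 2 / V = c * (β * vX * w) := by
      rw [hc]
      field_simp
      linear_combination -w ^ 2 * h2
    rw [h3]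
    linear_combination c * hcc + c ^ 2 * h2

lemma integral_sq_chanIn_linearEncoder (hs : IsSourceLaw src vX ρ r) (hvX : 0 < vX)
    (hPT : 0 < PT) (hV : 0 < 1 + 2 * α * ρ + α ^ 2 * r) (hβ : β = gain vX ρ r PT α) :
    ∫ ω, chanIn ω ^ 2 ∂(systemLaw src vZ (linearEncoder β α)) = PT := by
  have := hs.isProbabilityMeasure
  have h2 := sq_gain hvX hPT hV
  rw [← hβ] at h2
  have h3 := hs.integral_mul_linear β (β * α) β (β * α)
  rw [systemLaw_linearEncoder, integral_map (by fun_prop) (by unfold chanIn; fun_prop)]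
  have e : ∀ q : (ℝ × ℝ) × ℝ, chanIn (linearScheme β α q) ^ 2 =
      (fun p : ℝ × ℝ => (β * p.1 + β * α * p.2) * (β * p.1 + β * α * p.2)) q.1 := by
    intro q; simp only [chanIn, linearScheme_apply]; ring
  simp_rw [e]
  rw [integral_fun_fst (fun p : ℝ × ℝ => (β * p.1 + β * α * p.2) * (β * p.1 + β * α * p.2)), h3]
  simp only [probReal_univ, one_smul]
  linear_combination h2

/-- The linear decoder is a best response to the linear encoder; its distortion. -/
lemma isBestResponse_linear (hs : IsSourceLaw src vX ρ r) (hvX : 0 < vX) (hvZ : 0 < vZ)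
    (hPT : 0 < PT) (hV : 0 < 1 + 2 * α * ρ + α ^ 2 * r) (hβ : β = gain vX ρ r PT α)
    (hκ : κ = slope vX ρ r vZ PT α) :
    IsBestResponse (systemLaw src vZ (linearEncoder β α)) (fun y => κ * y) ∧
    distortion (systemLaw src vZ (linearEncoder β α)) (fun y => κ * y) =
      vX - PT / (PT + vZ) * vX * (1 + α * ρ) ^ 2 / (1 + 2 * α * ρ + α ^ 2 * r) := by
  have hY2 := memLp_chanOut_linearEncoder (vZ := vZ) hs β α
  obtain ⟨h1, h2⟩ := linearEncoder_regression hs hvX hvZ hPT hV hβ 1 0 κ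
    (by rw [hκ, hβ, slope_eq hvX hvZ hPT hV]; ring)
  obtain ⟨h3, h4, h5, -⟩ := linearEncoder_residual hs β α 1 0 κ h1
  simp only [one_mul, zero_mul, add_zero] at h2 h3 h4 h5
  refine ⟨⟨⟨by fun_prop, hY2.const_mul κ⟩, fun h' hh' => ?_⟩, ?_⟩
  · exact integral_sq_residual_le_of_indepFun κ hY2 h3 h4 h5 hh'.1 hh'.2
  · rw [distortion, h2]; ring

/-- The linear scheme satisfies either form of the privacy constraint as soon as the mean squared
error of the regression of `θ` on `Y` is at least `D_P`. A positive slope `κ` makes `κ Y` as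
informative as `Y`. -/
lemma privacy_linear (hs : IsSourceLaw src vX ρ r) (hvX : 0 < vX) (hvZ : 0 < vZ)
    (hPT : 0 < PT) (hDP : 0 < DP) (hV : 0 < 1 + 2 * α * ρ + α ^ 2 * r) (hα : 0 < 1 + α * ρ)
    (hβ : β = gain vX ρ r PT α) (hκ : κ = slope vX ρ r vZ PT α)
    (hc : PT / (PT + vZ) * vX * (ρ + α * r) ^ 2 ≤ (vX * r - DP) * (1 + 2 * α * ρ + α ^ 2 * r))
    {priv : PrivacyConstraint} (hpriv : priv = entropyPrivacy DP ∨ priv = mmsePrivacy DP) :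
    priv (systemLaw src vZ (linearEncoder β α)) (fun y => κ * y) := by
  have := hs.isProbabilityMeasure
  have : IsProbabilityMeasure (systemLaw src vZ (linearEncoder β α)) := isProbabilityMeasure_systemLaw
  have hκ0 : 0 < κ := hκ ▸ slope_pos hvX hvZ hPT hV hα
  have hY2 := memLp_chanOut_linearEncoder (vZ := vZ) hs β α
  set c := β * vX * (ρ + α * r) / (PT + vZ) with hcdef
  obtain ⟨h1, h2⟩ := linearEncoder_regression hs hvX hvZ hPT hV hβ 0 1 c
    (by rw [hcdef]; ring)
  obtain ⟨h3, h4, h5, h6⟩ := linearEncoder_residual hs β α 0 1 c h1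
  simp only [one_mul, zero_mul, zero_add] at h2 h3 h4 h5 h6
  set D := ∫ ω, (srcTheta ω - c * chanOut ω) ^ 2 ∂(systemLaw src vZ (linearEncoder β α))
  have hD : DP ≤ D := by
    have : PT / (PT + vZ) * vX * (ρ + α * r) ^ 2 / (1 + 2 * α * ρ + α ^ 2 * r) ≤ vX * r - DP := by
      rwa [div_le_iff₀ hV]
    rw [h2]
    linarith
  rcases hpriv with rfl | rfl
  · have hcond := condDiffEntropy_eq_of_indepFun (P := systemLaw src vZ (linearEncoder β α))
      (A := srcTheta) (B := fun ω => κ * chanOut ω) measurable_srcTheta (by fun_prop) (c / κ)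
      (hDP.trans_le hD) (by
        have e : ∀ ω, srcTheta ω - c / κ * (κ * chanOut ω) = srcTheta ω - c * chanOut ω := by
          intro ω; field_simp
        simp_rw [e]
        exact h5.comp (φ := id) (ψ := fun y => κ * y) measurable_id (by fun_prop)) (by
        have e : ∀ ω, srcTheta ω - c / κ * (κ * chanOut ω) = srcTheta ω - c * chanOut ω := by
          intro ω; field_simp
        simp_rw [e]
        exact h6)
    unfold entropyPrivacy
    rw [hcond, EReal.coe_le_coe_iff]
    gcongr
  · unfold mmsePrivacy
    obtain ⟨f, hf, hfe⟩ := (stronglyMeasurable_condExp (f := srcTheta)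
      (m := MeasurableSpace.comap chanOut inferInstance)
      (μ := systemLaw src vZ (linearEncoder β α))).measurable.exists_eq_measurable_comp
    have hC2 : MemLp ((systemLaw src vZ (linearEncoder β α))[srcTheta |
        MeasurableSpace.comap chanOut inferInstance]) 2 (systemLaw src vZ (linearEncoder β α)) :=
      (memLp_srcTheta hs).condExp one_le_two
    rw [hfe] at hC2 ⊢
    exact hD.trans (integral_sq_residual_le_of_indepFun c hY2 h3 h4 h5 hf hC2)

lemma isFeasible_linear (hs : IsSourceLaw src vX ρ r) (hvX : 0 < vX) (hvZ : 0 < vZ)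
    (hPT : 0 < PT) (hV : 0 < 1 + 2 * α * ρ + α ^ 2 * r)
    (hβ : β = gain vX ρ r PT α) (hκ : κ = slope vX ρ r vZ PT α) {priv : PrivacyConstraint}
    (hp : priv (systemLaw src vZ (linearEncoder β α)) (fun y => κ * y)) :
    IsFeasible src vZ PT priv (linearEncoder β α) (fun y => κ * y) where
  markov := inferInstance
  sq_integrable := memLp_chanIn_linearEncoder hs β α
  power := (integral_sq_chanIn_linearEncoder hs hvX hPT hV hβ).le
  response := (isBestResponse_linear hs hvX hvZ hPT hV hβ hκ).1
  privacy := hp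

/-- What the optimality proof needs to know of `α`: signs, the privacy of the linear scheme, and
complementary slackness (the privacy constraint is tight unless `α = 0`). -/
lemma alpha_spec (hvX : 0 < vX) (hρ : 0 ≤ ρ) (hr : ρ ^ 2 < r) (hvZ : 0 < vZ) (hPT : 0 < PT)
    (hDP' : DP ≤ vX * r) (hα : α = alpha vX ρ r vZ PT DP) :
    α ≤ 0 ∧ 0 ≤ ρ + α * r ∧ 0 < 1 + α * ρ ∧ 0 < 1 + 2 * α * ρ + α ^ 2 * r ∧
      PT / (PT + vZ) * vX * (ρ + α * r) ^ 2 ≤ (vX * r - DP) * (1 + 2 * α * ρ + α ^ 2 * r) ∧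
      (α = 0 ∨ PT / (PT + vZ) * vX * (ρ + α * r) ^ 2 =
        (vX * r - DP) * (1 + 2 * α * ρ + α ^ 2 * r)) := by
  have hr0 : 0 < r := (sq_nonneg ρ).trans_lt hr
  set Δ := privLevel vX r vZ PT DP with hΔ
  set Φ := Phi vX ρ r vZ PT DP with hΦ
  set e := 1 - ρ ^ 2 / r with he
  have he0 : 0 < e := by rw [he, sub_pos, div_lt_one hr0]; exact hr
  have hrel : vX * r - DP = PT / (PT + vZ) * vX * (r - Δ) := by
    rw [hΔ, privLevel]; field_simp; ring
  have hΔr : Δ ≤ r := by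
    by_contra hlt
    have : PT / (PT + vZ) * vX * (r - Δ) < 0 :=
      mul_neg_of_pos_of_neg (by positivity) (by linarith)
    linarith
  have hα' : α = -(ρ / r) + Φ := hα
  have e1 : ρ + α * r = r * Φ := by rw [hα']; field_simp; ring
  have e2 : 1 + α * ρ = e + ρ * Φ := by rw [hα', he]; field_simp; ring
  have e3 : 1 + 2 * α * ρ + α ^ 2 * r = r * Φ ^ 2 + e := by rw [hα', he]; field_simp; ring
  have hρr : 0 ≤ ρ / r := by positivity
  -- `Φ` lies in `[0, ρ / r]` and satisfies `r Δ Φ² ≤ (r - Δ) e`, tightly unless `Φ = ρ / r`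
  have hmain : 0 ≤ Φ ∧ Φ ≤ ρ / r ∧ r * Δ * Φ ^ 2 ≤ (r - Δ) * e ∧
      (Φ = ρ / r ∨ r * Δ * Φ ^ 2 = (r - Δ) * e) := by
    by_cases hpos : 0 < Δ
    · have hq : 0 ≤ e * (1 / Δ - 1 / r) :=
        mul_nonneg he0.le (sub_nonneg.2 (one_div_le_one_div_of_le hpos hΔr))
      have hval : Φ = min √(e * (1 / Δ - 1 / r)) (ρ / r) := by
        rw [hΦ, Phi, if_pos hpos]
      have hs := Real.sqrt_nonneg (e * (1 / Δ - 1 / r))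
      have hsq := Real.sq_sqrt hq
      have hprod : r * Δ * (e * (1 / Δ - 1 / r)) = (r - Δ) * e := by field_simp
      have hΦ0 : 0 ≤ Φ := by rw [hval]; exact le_min hs hρr
      refine ⟨hΦ0, by rw [hval]; exact min_le_right _ _, ?_, ?_⟩
      · have : Φ ^ 2 ≤ √(e * (1 / Δ - 1 / r)) ^ 2 :=
          pow_le_pow_left₀ hΦ0 (by rw [hval]; exact min_le_left _ _) 2
        rw [← hprod, ← hsq]
        gcongr
      · rcases min_choice √(e * (1 / Δ - 1 / r)) (ρ / r) with h | h
        · right; rw [hval, h, hsq, hprod]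
        · left; rw [hval, h]
    · have hval : Φ = ρ / r := by rw [hΦ, Phi, if_neg hpos]
      refine ⟨hval ▸ hρr, hval.le, ?_, .inl hval⟩
      have h1 : r * Δ * Φ ^ 2 ≤ 0 := mul_nonpos_of_nonpos_of_nonneg
        (mul_nonpos_of_nonneg_of_nonpos hr0.le (not_lt.1 hpos)) (sq_nonneg _)
      exact h1.trans (mul_nonneg (by linarith) he0.le)
  obtain ⟨h0, h1, h2, h3⟩ := hmain
  rw [e1, e2, e3, hrel]
  have hc : 0 < PT / (PT + vZ) * vX := by positivity
  refine ⟨by linarith, by positivity, by positivity, by positivity, ?_, ?_⟩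
  · rw [mul_assoc (PT / (PT + vZ) * vX)]
    refine mul_le_mul_of_nonneg_left ?_ hc.le
    linarith
  · rcases h3 with h | h
    · left; rw [hα', h]; ring
    · right
      linear_combination PT / (PT + vZ) * vX * h

/-- The two constraints on the moments `m = E X̂²` and `n = E θ X̂` bound `m` by its value for the
linear scheme: with `τ = √(c m / V)` they read `m + α n ≤ τ V` and, where `α ≠ 0`,
`n ≤ τ (ρ + α r)`, and as `α ≤ 0` they add up to `m ≤ τ (1 + α ρ)`. -/
lemma second_moment_le {c V m n W : ℝ} (hc : 0 < c) (hα : α ≤ 0) (hρα : 0 ≤ ρ + α * r)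
    (hV : 0 < V) (hVe : V = 1 + 2 * α * ρ + α ^ 2 * r) (hα1 : 0 < 1 + α * ρ)
    (hW : α = 0 ∨ c * (ρ + α * r) ^ 2 = W * V) (hm : 0 < m)
    (h1 : (m + α * n) ^ 2 ≤ c * V * m) (h2 : n ^ 2 ≤ W * m) :
    m ≤ c * (1 + α * ρ) ^ 2 / V ∧
      (c * (1 + α * ρ) ^ 2 / V ≤ m → m + α * n = c * (1 + α * ρ)) := by
  have hτ0 : 0 ≤ √(c * m / V) := Real.sqrt_nonneg _
  have hτ2 : √(c * m / V) ^ 2 = c * m / V := Real.sq_sqrt (by positivity)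
  set τ := √(c * m / V)
  have h3 : m + α * n ≤ τ * V := by
    refine abs_le_of_sq_le_sq' (h1.trans_eq ?_) (by positivity) |>.2
    rw [mul_pow, hτ2]; field_simp
  have h4 : -(α * n) ≤ -α * (τ * (ρ + α * r)) := by
    rcases hW with h | h
    · simp [h]
    · have : n ≤ τ * (ρ + α * r) := by
        refine abs_le_of_sq_le_sq' (h2.trans_eq ?_) (by positivity) |>.2
        rw [mul_pow, hτ2]
        field_simp
        linear_combination -h
      have := mul_le_mul_of_nonneg_left this (neg_nonneg.2 hα)
      linarith
  have h5 : m ≤ τ * (1 + α * ρ) := by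
    have : τ * (1 + α * ρ) = τ * V - α * (τ * (ρ + α * r)) := by rw [hVe]; ring
    linarith
  have h6 : m ≤ c * (1 + α * ρ) ^ 2 / V := by
    have h7 : m * m ≤ m * (c * (1 + α * ρ) ^ 2 / V) :=
      calc m * m ≤ (τ * (1 + α * ρ)) * (τ * (1 + α * ρ)) := mul_self_le_mul_self hm.le h5
        _ = m * (c * (1 + α * ρ) ^ 2 / V) := by
          rw [← pow_two, mul_pow, hτ2]; field_simp
    exact le_of_mul_le_mul_left h7 hm
  refine ⟨h6, fun h7 => ?_⟩
  have hτ : τ = c * (1 + α * ρ) / V := by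
    refine (pow_left_inj₀ hτ0 (by positivity) two_ne_zero).1 ?_
    rw [hτ2, le_antisymm h6 h7]
    field_simp
  have h8 : τ * V = c * (1 + α * ρ) := by rw [hτ]; field_simp
  have h9 : m = τ * (1 + α * ρ) := by rw [le_antisymm h6 h7, hτ]; field_simp
  have h10 : τ * (1 + α * ρ) = τ * V - α * (τ * (ρ + α * r)) := by rw [hVe]; ring
  linarith

lemma one_add_two_mul_pos (hr : ρ ^ 2 < r) (a : ℝ) : 0 < 1 + 2 * a * ρ + a ^ 2 * r := by
  rcases eq_or_ne a 0 with rfl | ha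
  · simp
  · have h1 : 0 < a ^ 2 * (r - ρ ^ 2) := mul_pos (by positivity) (by linarith)
    nlinarith [sq_nonneg (1 + a * ρ)]

/-- An encoder as good as the optimum without privacy has the second moments of the linear scheme
`U = β X`. -/
lemma cross_moment_of_optimal {priv : PrivacyConstraint} {g : Kernel (ℝ × ℝ) ℝ} {h : ℝ → ℝ}
    (hs : IsSourceLaw src vX ρ r) (hvX : 0 < vX) (hr : ρ ^ 2 < r) (hvZ : 0 < vZ) (hPT : 0 < PT)
    (hf : IsFeasible src vZ PT priv g h)
    (hm : PT / (PT + vZ) * vX ≤ ∫ ω, h (chanOut ω) ^ 2 ∂(systemLaw src vZ g)) :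
    ∫ ω, h (chanOut ω) ^ 2 ∂(systemLaw src vZ g) = PT / (PT + vZ) * vX ∧
    ∫ ω, srcTheta ω * h (chanOut ω) ∂(systemLaw src vZ g) = PT / (PT + vZ) * vX * ρ := by
  have hc : 0 < PT / (PT + vZ) * vX := by positivity
  have hm0 := hc.trans_le hm
  have key := fun a : ℝ => (hf.sq_le hs hvX hvZ hPT (one_add_two_mul_pos hr a) hm0).1
  set m := ∫ ω, h (chanOut ω) ^ 2 ∂(systemLaw src vZ g)
  set n := ∫ ω, srcTheta ω * h (chanOut ω) ∂(systemLaw src vZ g)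
  simp only [← mul_assoc] at key
  set c := PT / (PT + vZ) * vX
  have hmc : m = c := by
    refine le_antisymm ?_ hm
    have h0 := key 0
    simp only [mul_zero, zero_mul, add_zero, mul_one, ne_eq, OfNat.ofNat_ne_zero,
      not_false_eq_true, zero_pow] at h0
    rw [pow_two] at h0
    exact le_of_mul_le_mul_right h0 hm0
  rw [hmc] at key
  refine ⟨hmc, ?_⟩
  have hr0 : 0 < r := (sq_nonneg ρ).trans_lt hr
  -- `a ↦ c² V(a) - (c + a n)²` is nonnegative and vanishes at `a = 0`, hence is stationary there
  -- the increment is small enough for the linear term to dominate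
  have hK : 0 < c ^ 2 * r + 1 := by positivity
  have h1 := key (c * (n - c * ρ) / (c ^ 2 * r + 1))
  have h2 : (c * (n - c * ρ)) ^ 2 * (2 * (c ^ 2 * r + 1) + n ^ 2 - c ^ 2 * r) ≤ 0 := by
    set B := c * (n - c * ρ) with hB
    have h3 : (c * (1 + 2 * (B / (c ^ 2 * r + 1)) * ρ + (B / (c ^ 2 * r + 1)) ^ 2 * r) * c -
        (c + B / (c ^ 2 * r + 1) * n) ^ 2) * (c ^ 2 * r + 1) ^ 2 =
        -(B ^ 2 * (2 * (c ^ 2 * r + 1) + n ^ 2 - c ^ 2 * r)) := by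
      have hBn : c * n = B + c ^ 2 * ρ := by rw [hB]; ring
      field_simp
      linear_combination -2 * B * (c ^ 2 * r + 1) * hBn
    have h4 : 0 ≤ (c * (1 + 2 * (B / (c ^ 2 * r + 1)) * ρ + (B / (c ^ 2 * r + 1)) ^ 2 * r) * c -
        (c + B / (c ^ 2 * r + 1) * n) ^ 2) * (c ^ 2 * r + 1) ^ 2 :=
      mul_nonneg (by linarith) (by positivity)
    linarith
  have h5 : 0 < 2 * (c ^ 2 * r + 1) + n ^ 2 - c ^ 2 * r := by
    have : 0 < c ^ 2 * r := by positivity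
    nlinarith [sq_nonneg n]
  have h6 : (c * (n - c * ρ)) ^ 2 = 0 :=
    le_antisymm (nonpos_of_mul_nonpos_left h2 h5) (sq_nonneg _)
  have h7 := (mul_eq_zero.1 (pow_eq_zero_iff two_ne_zero |>.1 h6)).resolve_left hc.ne'
  linarith

end

end PrivateComm

end

open PrivateComm in
theorem theorem4 (src : Measure (ℝ × ℝ)) (vX ρ r vZ PT DP α β κ : ℝ)
    (hvX : 0 < vX) (hρ : 0 ≤ ρ) (hr : ρ ^ 2 < r) (hvZ : 0 < vZ) (hPT : 0 < PT)
    (hDP : 0 < DP) (hDP' : DP ≤ vX * r)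
    (hsrc : IsSourceLaw src vX ρ r)
    (hα : α = alpha vX ρ r vZ PT DP)
    (hβ : β = gain vX ρ r PT α)
    (hκ : κ = slope vX ρ r vZ PT α)
    (priv : PrivacyConstraint) (hpriv : priv = entropyPrivacy DP ∨ priv = mmsePrivacy DP) :
    IsEquilibrium src vZ PT priv (linearEncoder β α) (fun y => κ * y) ∧
    (∀ (g : Kernel (ℝ × ℝ) ℝ) (h : ℝ → ℝ), IsEquilibrium src vZ PT priv g h →
      ∃ ε : ℝ, (ε = 1 ∨ ε = -1) ∧
        (∀ᵐ p ∂src, g p = Measure.dirac (ε * (β * (p.1 + α * p.2)))) ∧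
        (∀ᵐ y, h y = ε * (κ * y))) ∧
    ((∃ (g : Kernel (ℝ × ℝ) ℝ) (h : ℝ → ℝ),
      IsEquilibrium src vZ PT noPrivacy g h ∧ priv (systemLaw src vZ g) h) → α = 0) := by
  have hr0 : 0 < r := (sq_nonneg ρ).trans_lt hr
  obtain ⟨hα0, hρα, hα1, hV, hle, heq⟩ := alpha_spec hvX hρ hr hvZ hPT hDP' hα
  have hc : 0 < PT / (PT + vZ) * vX := by positivity
  have hlin : IsFeasible src vZ PT priv (linearEncoder β α) (fun y => κ * y) :=
    isFeasible_linear hsrc hvX hvZ hPT hV hβ hκ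
      (privacy_linear hsrc hvX hvZ hPT hDP hV hα1 hβ hκ hle hpriv)
  have hdist := (isBestResponse_linear hsrc hvX hvZ hPT hV hβ hκ).2
  have hopt : ∀ {g : Kernel (ℝ × ℝ) ℝ} {h : ℝ → ℝ}, IsFeasible src vZ PT priv g h →
      0 < ∫ ω, h (chanOut ω) ^ 2 ∂(systemLaw src vZ g) → _ ∧ _ := fun {g h} hf hm =>
    have := hf.markov
    second_moment_le hc hα0 hρα hV rfl hα1 heq hm
      (by simpa only [mul_assoc] using (hf.sq_le hsrc hvX hvZ hPT hV hm).1)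
      (sq_integral_mul_le_of_privacy hpriv hDP hsrc hf.response hf.privacy hm)
  have hmstar : 0 < PT / (PT + vZ) * vX * (1 + α * ρ) ^ 2 / (1 + 2 * α * ρ + α ^ 2 * r) := by
    positivity
  refine ⟨⟨hlin, fun g' h' hf => ?_⟩, fun g h heqm => ?_, ?_⟩
  · have := hf.markov
    rw [hdist, hf.response.distortion_eq hsrc]
    rcases le_or_gt (∫ ω, h' (chanOut ω) ^ 2 ∂(systemLaw src vZ g')) 0 with hm | hm
    · linarith
    · linarith [(hopt hf hm).1]
  · obtain ⟨hf, hmin⟩ := heqm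
    have := hf.markov
    have h1 := hmin _ _ hlin
    rw [hdist, hf.response.distortion_eq hsrc] at h1
    have hm : 0 < ∫ ω, h (chanOut ω) ^ 2 ∂(systemLaw src vZ g) := by linarith
    obtain ⟨h2, h3⟩ := hopt hf hm
    have h4 := h3 (by linarith)
    have h5 := (hf.sq_le hsrc hvX hvZ hPT hV hm).2
    rw [h4, le_antisymm h2 (by linarith)] at h5
    obtain ⟨ε, hε, hg, hy⟩ := h5 (le_of_eq (by field_simp))
    refine ⟨ε, hε, by rw [hβ]; exact hg, ?_⟩
    have hg0 := gain_pos hvX hPT hV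
    have hsqrt : √(vX * (1 + 2 * α * ρ + α ^ 2 * r) * PT) =
        gain vX ρ r PT α * (vX * (1 + 2 * α * ρ + α ^ 2 * r)) := by
      rw [← Real.sqrt_mul_self (show 0 ≤ gain vX ρ r PT α * (vX * (1 + 2 * α * ρ + α ^ 2 * r)) by
        positivity)]
      congr 1
      linear_combination -(vX * (1 + 2 * α * ρ + α ^ 2 * r)) * sq_gain hvX hPT hV
    filter_upwards [hy] with y hy
    rw [hsqrt] at hy
    rw [hκ, slope_eq hvX hvZ hPT hV]
    set b := gain vX ρ r PT α
    set V := 1 + 2 * α * ρ + α ^ 2 * r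
    field_simp at hy ⊢
    linear_combination hy
  · rintro ⟨g, h, ⟨hf, hmin⟩, hp⟩
    have := hf.markov
    have hV0 : 0 < 1 + 2 * (0 : ℝ) * ρ + 0 ^ 2 * r := by norm_num
    have h1 := hmin _ _ (isFeasible_linear (priv := noPrivacy) hsrc hvX hvZ hPT hV0 rfl rfl trivial)
    rw [(isBestResponse_linear hsrc hvX hvZ hPT hV0 rfl rfl).2,
      hf.response.distortion_eq hsrc] at h1
    have h1 : PT / (PT + vZ) * vX ≤ ∫ ω, h (chanOut ω) ^ 2 ∂(systemLaw src vZ g) := by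
      norm_num at h1
      linarith
    obtain ⟨h2, h3⟩ := cross_moment_of_optimal hsrc hvX hr hvZ hPT hf h1
    have h4 := sq_integral_mul_le_of_privacy hpriv hDP hsrc hf.response hp
      (hc.trans_le h1)
    rw [h2, h3] at h4
    set c := PT / (PT + vZ) * vX
    have h5 : c * ρ ^ 2 ≤ vX * r - DP := by
      refine le_of_mul_le_mul_right ?_ hc
      linarith
    rcases heq with h6 | h6
    · exact h6
    · have h7 := mul_le_mul_of_nonneg_right h5 hV.le
      rw [← h6] at h7
      -- here `α < 0` would give `2 ρ + α r ≤ 0`, while `ρ + α r ≥ 0` and `ρ ≥ 0`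
      have h8 : 0 ≤ c * (α * ((r - ρ ^ 2) * (2 * ρ + α * r))) := by linear_combination h7
      by_contra hne
      have h9 : α < 0 := lt_of_le_of_ne hα0 hne
      have h10 : (r - ρ ^ 2) * (2 * ρ + α * r) ≤ 0 :=
        nonpos_of_mul_nonneg_right (nonneg_of_mul_nonneg_right h8 hc) h9
      have h11 : 2 * ρ + α * r ≤ 0 := nonpos_of_mul_nonpos_right h10 (by linarith)
      have h12 : 0 ≤ α * r := by linarith
      exact absurd (mul_neg_of_neg_of_pos h9 hr0) (not_lt.2 h12)
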